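/- Let $0\le k\le n$ be integers and let $f:\{0,1\}^n\to\{0,1\}$ be the $k$-of-$n$ function: $f(a)=1$ iff at least $k$ bits of $a$ equal $1$. In the Scenario Boolean Function Evaluation problem for $f$ one is given costs $c_1,\dots,c_n>0$, a nonempty sample $S\subseteq\{0,1\}^n$ and positive integer weights $w(a)$, $a\in S$. One seeks a decision tree that queries bits and computes $f(a)$ correctly for every $a\in\{0,1\}^n$ (in $S$ or not), of small expected cost. The cost on $a$ is $\sum_{i\in M}c_i$, where $M$ is the set of bits queried on $a$, and the expectation is over $a\in S$ with probability $w(a)/\sum_{a'\in S}w(a')$. For $b\in\{0,1,*\}^n$ let $g_1(b)=\min\{k,|\{i:b_i=1\}|\}$ and $g_0(b)=\min\{n-k+1,|\{i:b_i=0\}|\}$. Let $Q=k(n-k+1)$ and let $g(b)=Q-\big((n-k+1)-g_0(b)\big)\big(k-g_1(b)\big)$. Write $b_{i\leftarrow\gamma}$ for $b$ with entry $i$ replaced by $\gamma$, and $\Delta g(b,i,\gamma)=g(b_{i\leftarrow\gamma})-g(b)$. Write $b'\succeq b$ if $b'_i=b_i$ whenever $b_i\ne *$. **(1)** The function $g$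 is monotone ($\Delta g(b,i,\gamma)\ge 0$ if $b_i=*$) and submodular ($\Delta g(b,i,\gamma)\ge\Delta g(b',i,\gamma)$ if $b'\succeq b$, $b'\neq b$ and $b_i=b'_i=*$). It has goal value $Q$ ($g(a)=Q$ for all $a\in\{0,1\}^n$), and $g(b)=Q$ iff $b$ has at least $n-k+1$ zeros or at least $k$ ones. Moreover, if $k\ge 1$, then $$\rho:=\min\Big\{\frac{\Delta g(b,i,\gamma)}{Q-g(b)}\;:\;g(b)<Q,\ b_i=*,\ \gamma\ne\gamma_{b,i}\Big\}$$ exists and satisfies $\rho\ge 1/k$, where $\gamma_{b,i}$ is a state minimizing $\Delta g(b,i,\cdot)$, ties being broken arbitrarily. **(2)** There is an absolute constant $C>0$ such that the following holds for all $0\le k\le n$ and all $S,w,c$ as above, however Mixed Greedy (described below) breaks ties. The tree built by Mixed Greedy on $(g,Q,S,w,c)$ repeats no item on any root-leaf path and reaches utility $Q$ on every $a\in\{0,1\}^n$. Labeling each of its leaves by $1$ if at least $k$ ones have been seen on the path to it, and by $0$ otherwise, gives a decision tree that computes $f$. If $n\ge2$, the expected cost of this tree is at most $C\,k\log n$ times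 the expected cost of any decision tree computing $f$. In particular the bound does not depend on the sample size or the weights. **Mixed Greedy.** The call on $b$ (initially $b=(*,\dots,*)$) returns a leaf if $g(b)=Q$. Otherwise let $N'=\{i:b_i=*\}$; for $i\in N'$ let $\sigma_i$ minimize $\Delta g(b,i,\cdot)$; for $U\subseteq N'$ let $b_U$ be $b$ with $b_i$ set to $\sigma_i$ for $i\in U$; and let $g'(U)=g(b_U)-g(b)$. Let $B$ be the smallest number in $[0,\sum_{i\in N'}c_i]$ for which Wolsey's greedy algorithm with budget $B$, applied to $g'$, returns a set of $g'$-value at least $\alpha g'(N')$, where $\alpha=1-e^{-\chi}$ and $e^{\chi}=2-\chi$. (Wolsey's algorithm repeatedly adds, among the remaining items of cost at most $B$, one with the largest ratio of marginal value to cost, until more than $B$ is spent or no candidate is left. It returns either the last item alone or the set of all other chosen items, whichever has the larger value.) Then a path of nodes, the backbone, is built. In a first stage, items of cost at most $B$ are chosen one by one so as to maximize $(h(R\cup\{i\})-h(R))/c_i$, where $R$ is the set of items chosen so far and $h(R)$ is the total weight of the $a\in S$ with $a\succeq b$ and $a_i\ne\sigma_i$ for some $i\in R$; it ends when at least $B$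 has been spent. In a second stage, further items of cost at most $B$ are chosen so as to maximize the increase of $g$ (with all chosen items $i$ set to $\sigma_i$) per unit cost, until at least $B$ has been spent in this stage or no candidate is left. The backbone continues along the $\sigma_i$-child of each node labeled $i$. The other children, and the end of the backbone, are built by recursive calls on their partial realizations. -/

import Mathlib

open scoped BigOperators

noncomputable section

/-! ## Partial realizations and utility functions -/

/-- An element of `(Γ ∪ {*})ⁿ`; the value `none` stands for `*`. -/
abbrev PartialReal (n : ℕ) (Γ : Type) : Type := Fin n → Option Γ

/-- A (full) realization, seen as a partial realization without `*`. -/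
def fullReal {n : ℕ} {Γ : Type} (a : Fin n → Γ) : PartialReal n Γ := fun i => some (a i)

/-- The partial realization `b_{i ← γ}`. -/
def setState {n : ℕ} {Γ : Type} (b : PartialReal n Γ) (i : Fin n) (γ : Γ) : PartialReal n Γ :=
  Function.update b i (some γ)

/-- The partial realization `b_U` obtained from `b` by setting item `i` to `σ i` for all `i ∈ U`. -/
def setStates {n : ℕ} {Γ : Type} (b : PartialReal n Γ) (σ : Fin n → Γ) (U : Finset (Fin n)) :
    PartialReal n Γ :=
  fun i => if i ∈ U then some (σ i) else b i

/-- `b' ⪰ b`: the partial realization `b'` is an extension of `b`. -/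
def Extends {n : ℕ} {Γ : Type} (b' b : PartialReal n Γ) : Prop :=
  ∀ i, b i ≠ none → b' i = b i

/-- `Δg(b, i, γ) = g(b_{i ← γ}) - g(b)`. -/
def gain {n : ℕ} {Γ : Type} (g : PartialReal n Γ → ℕ) (b : PartialReal n Γ) (i : Fin n) (γ : Γ) :
    ℝ :=
  (g (setState b i γ) : ℝ) - (g b : ℝ)

def UtilityMonotone {n : ℕ} {Γ : Type} (g : PartialReal n Γ → ℕ) : Prop :=
  ∀ (b : PartialReal n Γ) (i : Fin n) (γ : Γ), b i = none → g b ≤ g (setState b i γ)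

def UtilitySubmodular {n : ℕ} {Γ : Type} (g : PartialReal n Γ → ℕ) : Prop :=
  ∀ (b b' : PartialReal n Γ) (i : Fin n) (γ : Γ), Extends b' b → b' ≠ b →
    b i = none → b' i = none → gain g b' i γ ≤ gain g b i γ

/-- `g` has goal value `Q`. -/
def HasGoalValue {n : ℕ} {Γ : Type} (g : PartialReal n Γ → ℕ) (Q : ℕ) : Prop :=
  ∀ a : Fin n → Γ, g (fullReal a) = Q

/-- `wc b i` is a worst-case state of an undetermined item `i`: a state that minimizes
`Δg(b, i, ·)`. Ties may be broken arbitrarily. -/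
def IsWorstCase {n : ℕ} {Γ : Type} (g : PartialReal n Γ → ℕ)
    (wc : PartialReal n Γ → Fin n → Γ) : Prop :=
  ∀ (b : PartialReal n Γ) (i : Fin n), b i = none → ∀ γ : Γ, gain g b i (wc b i) ≤ gain g b i γ

/-- `ρ = min Δg(b, i, γ) / (Q - g(b))`, the minimum being over all `b` with `g(b) < Q`, all items
`i` with `b i = *` and all states `γ` other than the worst-case state. -/
def IsRho {n : ℕ} {Γ : Type} (g : PartialReal n Γ → ℕ) (Q : ℕ)
    (wc : PartialReal n Γ → Fin n → Γ) (ρ : ℝ) : Prop :=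
  IsLeast {r : ℝ | ∃ (b : PartialReal n Γ) (i : Fin n) (γ : Γ),
    g b < Q ∧ b i = none ∧ γ ≠ wc b i ∧ r = gain g b i γ / ((Q : ℝ) - (g b : ℝ))} ρ

/-- The standard OR construction (used only with `g₀ ≤ Q₀` and `g₁ ≤ Q₁`, so that no subtraction
is truncated). -/
def orCombine {n : ℕ} {Γ : Type} (Q₀ Q₁ : ℕ) (g₀ g₁ : PartialReal n Γ → ℕ) :
    PartialReal n Γ → ℕ :=
  fun b => Q₀ * Q₁ - (Q₀ - g₀ b) * (Q₁ - g₁ b)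

/-! ## Decision trees -/

/-- Decision trees whose internal nodes are labeled with items, have one child for each state, and
whose leaves carry an element of `β` (`β = Unit` for unlabeled leaves). -/
inductive DTree (n : ℕ) (Γ β : Type) : Type
  | leaf (out : β) : DTree n Γ β
  | node (i : Fin n) (child : Γ → DTree n Γ β) : DTree n Γ β

/-- The set of items labeling the nodes on the root-leaf path followed on `a`. -/
def DTree.queried {n : ℕ} {Γ β : Type} (a : Fin n → Γ) : DTree n Γ β → Finset (Fin n)
  | .leaf _ => ∅
  | .node i child => insert i (DTree.queried a (child (a i)))

/-- The label of the leaf reached on `a`. -/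
def DTree.output {n : ℕ} {Γ β : Type} (a : Fin n → Γ) : DTree n Γ β → β
  | .leaf out => out
  | .node i child => DTree.output a (child (a i))

/-- The partial realization associated with the root-leaf path followed on `a`. -/
def DTree.pathReal {n : ℕ} {Γ β : Type} (T : DTree n Γ β) (a : Fin n → Γ) : PartialReal n Γ :=
  fun i => if i ∈ T.queried a then some (a i) else none

/-- No root-leaf path contains an item twice, or an item of `U`. -/
def DTree.NoRepeat {n : ℕ} {Γ β : Type} : DTree n Γ β → Finset (Fin n) → Prop
  | .leaf _, _ => True
  | .node i child, U => i ∉ U ∧ ∀ γ, DTree.NoRepeat (child γ) (insert i U)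

/-- Relabel every leaf by `φ` of the partial realization of the path that leads to it;
`b` is the partial realization at the root. -/
def DTree.relabel {n : ℕ} {Γ β β' : Type} (φ : PartialReal n Γ → β') :
    DTree n Γ β → PartialReal n Γ → DTree n Γ β'
  | .leaf _, b => .leaf (φ b)
  | .node i child, b => .node i fun γ => DTree.relabel φ (child γ) (setState b i γ)

/-- The cost `κ(T, a)` incurred when `T` is used on `a`. -/
def DTree.cost {n : ℕ} {Γ β : Type} (c : Fin n → ℝ) (T : DTree n Γ β) (a : Fin n → Γ) : ℝ :=
  ∑ i ∈ T.queried a, c i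

/-- The expected cost of `T` with respect to the sample distribution, which gives `a ∈ S` the
probability `w a / ∑ a' ∈ S, w a'`. -/
def expectedCost {n : ℕ} {Γ β : Type} (S : Finset (Fin n → Γ)) (w : (Fin n → Γ) → ℕ)
    (c : Fin n → ℝ) (T : DTree n Γ β) : ℝ :=
  ∑ a ∈ S, ((w a : ℝ) / ∑ a' ∈ S, (w a' : ℝ)) * T.cost c a

/-- `T` is a strategy for the Scenario Submodular Cover problem with utility `g` and goal value
`Q`: it selects items without repetition and reaches utility `Q` on all realizations. -/
def IsCoverStrategy {n : ℕ} {Γ β : Type} (g : PartialReal n Γ → ℕ) (Q : ℕ)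
    (T : DTree n Γ β) : Prop :=
  T.NoRepeat ∅ ∧ ∀ a : Fin n → Γ, g (T.pathReal a) = Q

/-- `T` computes the Boolean function `f`, on all assignments (inside the sample or not). -/
def Computes {n : ℕ} (T : DTree n Bool Bool) (f : (Fin n → Bool) → Bool) : Prop :=
  ∀ a : Fin n → Bool, T.output a = f a

/-! ## The Mixed Greedy algorithm -/

/-- A rule for choosing, from a nonempty set of candidate items, one with maximum score. -/
def IsArgmaxRule {n : ℕ} (pick : Finset (Fin n) → (Fin n → ℝ) → Fin n) : Prop :=
  ∀ (I : Finset (Fin n)) (score : Fin n → ℝ), I.Nonempty →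
    pick I score ∈ I ∧ ∀ j ∈ I, score j ≤ score (pick I score)

/-- The way in which a run of Mixed Greedy breaks ties: a minimizing state for each item, and
argmax rules for Wolsey's greedy algorithm and for the two greedy stages. All of them may depend
on the partial realization of the current call. -/
structure TieBreaking (n : ℕ) (Γ : Type) (g : PartialReal n Γ → ℕ) where
  sigma : PartialReal n Γ → Fin n → Γ
  sigma_spec : IsWorstCase g sigma
  wolsey : PartialReal n Γ → Finset (Fin n) → (Fin n → ℝ) → Fin n
  wolsey_spec : ∀ b, IsArgmaxRule (wolsey b)
  stage₁ : PartialReal n Γ → Finset (Fin n) → (Fin n → ℝ) → Fin n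
  stage₁_spec : ∀ b, IsArgmaxRule (stage₁ b)
  stage₂ : PartialReal n Γ → Finset (Fin n) → (Fin n → ℝ) → Fin n
  stage₂_spec : ∀ b, IsArgmaxRule (stage₂ b)

open Classical in
/-- A greedy loop. `I` is the set of remaining candidates, `R` the set of items chosen so far and
`spent` their total cost. Until `I` is empty or `halt spent` holds, an item of `I` maximizing
`(F (R ∪ {i}) - F R) / c i` is chosen. The first argument bounds the number of rounds (it is always
called with the number of candidates). The result is the list of chosen items, in order. -/
def greedyLoop {n : ℕ} (pick : Finset (Fin n) → (Fin n → ℝ) → Fin n)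
    (F : Finset (Fin n) → ℝ) (c : Fin n → ℝ) (halt : ℝ → Prop) :
    ℕ → Finset (Fin n) → Finset (Fin n) → ℝ → List (Fin n)
  | 0, _, _, _ => []
  | m + 1, I, R, spent =>
    if I = ∅ ∨ halt spent then []
    else
      let i := pick I fun j => (F (insert j R) - F R) / c j
      i :: greedyLoop pick F c halt m (I.erase i) (insert i R) (spent + c i)

/-- Run the greedy loop on the items of `N` of cost at most `B`. -/
def greedyRun {n : ℕ} (pick : Finset (Fin n) → (Fin n → ℝ) → Fin n)
    (F : Finset (Fin n) → ℝ) (c : Fin n → ℝ) (halt : ℝ → Prop) (N : Finset (Fin n)) (B : ℝ) :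
    List (Fin n) :=
  greedyLoop pick F c halt (N.filter fun i => c i ≤ B).card (N.filter fun i => c i ≤ B) ∅ 0

/-- Wolsey's greedy algorithm for maximizing `F` over subsets of `N` within the budget `B`: choose
items greedily until more than `B` is spent or no candidate is left, then return the last chosen
item or all the other chosen items, whichever is better. -/
def wolseyGreedy {n : ℕ} (pick : Finset (Fin n) → (Fin n → ℝ) → Fin n)
    (N : Finset (Fin n)) (F : Finset (Fin n) → ℝ) (c : Fin n → ℝ) (B : ℝ) : Finset (Fin n) :=
  match (greedyRun pick F c (fun spent => B < spent) N B).reverse with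
  | [] => ∅
  | last :: rest => if F rest.toFinset ≤ F {last} then {last} else rest.toFinset

theorem exists_chi : ∃ χ : ℝ, Real.exp χ = 2 - χ := by
  have hc : ContinuousOn (fun x : ℝ => Real.exp x + x) (Set.Icc 0 2) := by fun_prop
  have h := intermediate_value_Icc (by norm_num : (0 : ℝ) ≤ 2) hc
  have hm : (2 : ℝ) ∈ Set.Icc (Real.exp 0 + 0) (Real.exp 2 + 2) := by
    refine ⟨by simp, ?_⟩
    have := Real.exp_pos 2
    linarith
  obtain ⟨x, _, hx⟩ := h hm
  exact ⟨x, by simp only at hx; linarith⟩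

/-- The (unique) solution of `e ^ χ = 2 - χ`. -/
def chi : ℝ := exists_chi.choose

/-- `α = 1 - e ^ (-χ) ≈ 0.35`. -/
def wolseyAlpha : ℝ := 1 - Real.exp (-chi)

/-- The smallest `B ∈ [0, ∑ i ∈ N, c i]` such that Wolsey's greedy algorithm with budget `B`
returns a set of utility at least `α * F N`. -/
def findBudget {n : ℕ} (pick : Finset (Fin n) → (Fin n → ℝ) → Fin n)
    (N : Finset (Fin n)) (F : Finset (Fin n) → ℝ) (c : Fin n → ℝ) : ℝ :=
  sInf {B : ℝ | 0 ≤ B ∧ B ≤ ∑ i ∈ N, c i ∧ wolseyAlpha * F N ≤ F (wolseyGreedy pick N F c B)}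

open Classical in
/-- `h(R)`: the total weight of the `a ∈ S` with `a ⪰ b` and `a i ≠ σ i` for some `i ∈ R`. -/
def removedWeight {n : ℕ} {Γ : Type} (S : Finset (Fin n → Γ)) (w : (Fin n → Γ) → ℕ)
    (b : PartialReal n Γ) (σ : Fin n → Γ) (R : Finset (Fin n)) : ℝ :=
  ∑ a ∈ S.filter (fun a => Extends (fullReal a) b ∧ ∃ i ∈ R, a i ≠ σ i), (w a : ℝ)

open Classical in
/-- The items labeling the backbone built by the call on `b`: those of the first stage (greedy for
the removed weight, until at least `B` is spent), then those of the second stage (greedy for the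
utility under `σ`, until at least `B` is spent or no candidate is left). Both stages use items of
cost at most `B` only. -/
def backboneItems {n : ℕ} {Γ : Type} {g : PartialReal n Γ → ℕ} (tb : TieBreaking n Γ g)
    (S : Finset (Fin n → Γ)) (w : (Fin n → Γ) → ℕ) (c : Fin n → ℝ) (b : PartialReal n Γ) :
    List (Fin n) :=
  let N : Finset (Fin n) := Finset.univ.filter fun i => b i = none
  let σ : Fin n → Γ := tb.sigma b
  let B : ℝ := findBudget (tb.wolsey b) N (fun U => (g (setStates b σ U) : ℝ) - (g b : ℝ)) c
  let Y₁ : List (Fin n) :=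
    greedyRun (tb.stage₁ b) (removedWeight S w b σ) c (fun spent => B ≤ spent) N B
  let Y₂ : List (Fin n) :=
    greedyRun (tb.stage₂ b) (fun U => (g (setStates b σ (Y₁.toFinset ∪ U)) : ℝ)) c
      (fun spent => B ≤ spent) (N \ Y₁.toFinset) B
  Y₁ ++ Y₂

open Classical in
/-- The tree with the backbone labeled by a given list of items: the `σ i`-child of a node labeled
`i` continues the backbone, the other children, and the end of the backbone, are the trees that
`call` builds. -/
def attachBackbone {n : ℕ} {Γ : Type} (call : PartialReal n Γ → DTree n Γ Unit) (σ : Fin n → Γ) :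
    List (Fin n) → PartialReal n Γ → DTree n Γ Unit
  | [], b => call b
  | i :: L, b => .node i fun γ =>
      if γ = σ i then attachBackbone call σ L (setState b i (σ i)) else call (setState b i γ)

/-- The recursive function `MixedGreedy(g, Q, S, w, c, b)`. The first numerical argument bounds the
depth of the recursion; each recursive call has fewer undetermined items than its caller, so the
number of undetermined items is a sufficient bound. -/
def mixedGreedyRec {n : ℕ} {Γ : Type} (g : PartialReal n Γ → ℕ) (Q : ℕ) (tb : TieBreaking n Γ g)
    (S : Finset (Fin n → Γ)) (w : (Fin n → Γ) → ℕ) (c : Fin n → ℝ) :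
    ℕ → PartialReal n Γ → DTree n Γ Unit
  | 0, _ => .leaf ()
  | m + 1, b =>
    if g b = Q then .leaf ()
    else attachBackbone (mixedGreedyRec g Q tb S w c m) (tb.sigma b) (backboneItems tb S w c b) b

/-- The tree built by Mixed Greedy for the Scenario Submodular Cover instance
`(g, Q, S, w, c)`. -/
def mixedGreedy {n : ℕ} {Γ : Type} (g : PartialReal n Γ → ℕ) (Q : ℕ) (tb : TieBreaking n Γ g)
    (S : Finset (Fin n → Γ)) (w : (Fin n → Γ) → ℕ) (c : Fin n → ℝ) : DTree n Γ Unit :=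
  mixedGreedyRec g Q tb S w c n fun _ => none

/-! ## `k`-of-`n` functions -/

/-- The number of items that have state `γ` in `b`. -/
def countState {n : ℕ} (γ : Bool) (b : PartialReal n Bool) : ℕ :=
  (Finset.univ.filter fun i => b i = some γ).card

/-- The Boolean `k`-of-`n` function. -/
def kOfN (n k : ℕ) (a : Fin n → Bool) : Bool :=
  decide (k ≤ (Finset.univ.filter fun i => a i = true).card)

/-- The OR combination of the capped count `g₀` of the 0s, with goal value `n - k + 1`, and the
capped count `g₁` of the 1s, with goal value `k`. -/
def kOfNUtility (n k : ℕ) : PartialReal n Bool → ℕ :=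
  orCombine (n - k + 1) k
    (fun b => min (n - k + 1) (countState false b))
    (fun b => min k (countState true b))

/-- The goal value `Q = k (n - k + 1)`. -/
def kOfNGoal (n k : ℕ) : ℕ := k * (n - k + 1)

/-- The evaluation tree obtained from Mixed Greedy on the utility above: each leaf is labeled 1 if
at least `k` ones have been seen on the way to it, and 0 otherwise. -/
def kOfNTree (n k : ℕ) (tb : TieBreaking n Bool (kOfNUtility n k)) (S : Finset (Fin n → Bool))
    (w : (Fin n → Bool) → ℕ) (c : Fin n → ℝ) : DTree n Bool Bool :=
  (mixedGreedy (kOfNUtility n k) (kOfNGoal n k) tb S w c).relabel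
    (fun b => decide (k ≤ countState true b)) fun _ => none

end

/-! Write gap(b) = Q - g(b), which is the product of the number of zeros and the number of ones
still missing (`kOfNGap`). Monotonicity, submodularity and the goal value are read off this product.
A state that is not the worst case gains at least as much as state `true`; while the gap is
positive, one more 1 removes a fraction 1/(k - #ones) ≥ 1/k of it, whence ρ ≥ 1/k
(`gap_le_mul_gain`).

For the cost, fix a tree `T` that computes the function. One backbone costs at most 24 times what
`T` pays for the items still undetermined (`BackboneSpec.cost_le`). Let x be the realization that
completes b by the worst-case states. By the guarantee of Wolsey's algorithm, B is at most the cost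
of any set that reaches the goal under these states, and the path of `T` on x contains such a set.
If `T` pays less than t ≤ B on a, then a must leave the path of x within its prefix of cost at most
t (`exists_prefix`). So these prefixes form a min-sum set cover solution in which a is covered no
later than `T` finishes on it. The greedy first stage is within a factor 8 of that solution
(`greedy_minSum`). The second stage costs at most 2B times the surviving weight, which is at most
another 16 times the cost of `T`.

Every recursive call starts with a smaller gap: by a factor 1 - 1/k off the backbone, and 1 - α/2 at
its end, since the second stage closes half of the gap to a set of value at least α gap(b)
(`BackboneSpec.gap_end_le`). The calls made by one backbone act on disjoint sets of realizations, so
the costs of `T` charged to them add up to at most the cost charged to the caller. Only the depth of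
the recursion counts: it is O(k log gap), and gap ≤ n². Neither the sample size nor the weights
enter (`weightedCost_mixedGreedyRec_le`). -/

open scoped BigOperators

noncomputable section

/-! ## Greedy runs -/

/-- The specification of a greedy run over the candidates `I`. -/
def IsGreedyTrace {n : ℕ} (F : Finset (Fin n) → ℝ) (c : Fin n → ℝ) (halt : ℝ → Prop)
    (I : Finset (Fin n)) (L : List (Fin n)) : Prop :=
  (∀ L₁ i L₂, L = L₁ ++ i :: L₂ → i ∈ I ∧ i ∉ L₁ ∧ ¬ halt (L₁.map c).sum ∧
    ∀ j ∈ I, j ∉ L₁ → (F (insert j L₁.toFinset) - F L₁.toFinset) / c j ≤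
      (F (insert i L₁.toFinset) - F L₁.toFinset) / c i) ∧
  ((∀ j ∈ I, j ∈ L) ∨ halt (L.map c).sum)

/-- Loop invariant: `L₀` lists the items chosen so far, and `I`, `R`, `s` are determined by it. As
`m` bounds the number of remaining candidates, the loop never stops merely because the rounds are
exhausted. -/
theorem greedyLoop_spec {n : ℕ} {pick : Finset (Fin n) → (Fin n → ℝ) → Fin n}
    (hp : IsArgmaxRule pick) (F : Finset (Fin n) → ℝ) (c : Fin n → ℝ) (halt : ℝ → Prop)
    (I₀ : Finset (Fin n)) (m : ℕ) (I : Finset (Fin n)) (L₀ : List (Fin n)) (R : Finset (Fin n))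
    (s : ℝ) (hI : I = I₀ \ L₀.toFinset) (hm : I.card ≤ m) (hR : R = L₀.toFinset)
    (hs : s = (L₀.map c).sum) :
    (∀ L₁ i L₂, greedyLoop pick F c halt m I R s = L₁ ++ i :: L₂ →
      i ∈ I₀ ∧ i ∉ L₀ ++ L₁ ∧ ¬ halt ((L₀ ++ L₁).map c).sum ∧
      ∀ j ∈ I₀, j ∉ L₀ ++ L₁ →
        (F (insert j (L₀ ++ L₁).toFinset) - F (L₀ ++ L₁).toFinset) / c j ≤
          (F (insert i (L₀ ++ L₁).toFinset) - F (L₀ ++ L₁).toFinset) / c i) ∧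
    ((∀ j ∈ I₀, j ∈ L₀ ++ greedyLoop pick F c halt m I R s) ∨
      halt ((L₀ ++ greedyLoop pick F c halt m I R s).map c).sum) := by
  induction m generalizing I L₀ R s with
  | zero =>
    have hE : I = ∅ := by simpa using hm
    refine ⟨by simp [greedyLoop], Or.inl fun j hj => ?_⟩
    by_contra hj'
    have : j ∈ I := by rw [hI]; simpa [greedyLoop, hj] using hj'
    simp [hE] at this
  | succ m ih =>
    by_cases hc : I = ∅ ∨ halt s
    · have hl : greedyLoop pick F c halt (m + 1) I R s = [] := by simp [greedyLoop, hc]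
      rw [hl]
      refine ⟨by simp, ?_⟩
      rcases hc with hc | hc
      · left
        intro j hj
        by_contra hj'
        have : j ∈ I := by rw [hI]; simpa [hj] using hj'
        simp [hc] at this
      · right
        simpa [← hs] using hc
    · set i := pick I fun j => (F (insert j R) - F R) / c j with hi
      have hl : greedyLoop pick F c halt (m + 1) I R s =
          i :: greedyLoop pick F c halt m (I.erase i) (insert i R) (s + c i) := by
        simp [greedyLoop, hc, hi]
      rw [hl]
      push Not at hc
      have hpk := hp I (fun j => (F (insert j R) - F R) / c j) hc.1
      rw [← hi] at hpk
      have hi1 := hpk.1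
      rw [hI] at hi1
      have := ih (I.erase i) (L₀ ++ [i]) (insert i R) (s + c i)
        (by rw [hI]; ext x; simp; tauto)
        (by rw [Finset.card_erase_of_mem hpk.1]; omega)
        (by rw [hR]; ext x; simp)
        (by simp [hs])
      refine ⟨?_, by simpa using this.2⟩
      intro L₁ i' L₂ h
      rcases L₁ with _ | ⟨x, L₁⟩
      · simp only [List.nil_append, List.cons.injEq] at h
        rw [← h.1]
        simp only [Finset.mem_sdiff, List.mem_toFinset] at hi1
        refine ⟨hi1.1, by simpa using hi1.2, by simpa [← hs] using hc.2, ?_⟩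
        intro j hj hj'
        have := hpk.2 j (by rw [hI]; simpa [hj] using hj')
        simpa [hR] using this
      · simp only [List.cons_append, List.cons.injEq] at h
        have h2 := this.1 L₁ i' L₂ h.2
        rw [h.1] at h2
        simpa using h2

theorem greedyRun_isGreedyTrace {n : ℕ} {pick : Finset (Fin n) → (Fin n → ℝ) → Fin n}
    (hp : IsArgmaxRule pick) (F : Finset (Fin n) → ℝ) (c : Fin n → ℝ) (halt : ℝ → Prop)
    (N : Finset (Fin n)) (B : ℝ) :
    IsGreedyTrace F c halt (N.filter fun i => c i ≤ B) (greedyRun pick F c halt N B) := by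
  have h := greedyLoop_spec hp F c halt (N.filter fun i => c i ≤ B) _
    (N.filter fun i => c i ≤ B) [] ∅ 0 (by simp) le_rfl (by simp) (by simp)
  simp only [List.nil_append] at h
  exact h

section Trace

variable {n : ℕ} {F : Finset (Fin n) → ℝ} {c : Fin n → ℝ} {halt : ℝ → Prop}
  {I : Finset (Fin n)} {L : List (Fin n)}

theorem IsGreedyTrace.mem (h : IsGreedyTrace F c halt I L) {i : Fin n} (hi : i ∈ L) : i ∈ I := by
  obtain ⟨L₁, L₂, rfl⟩ := List.append_of_mem hi
  exact (h.1 L₁ i L₂ rfl).1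

theorem IsGreedyTrace.nodup (h : IsGreedyTrace F c halt I L) : L.Nodup := by
  rw [← List.reverse_reverse L, List.nodup_reverse]
  have key : ∀ L₁ : List (Fin n), (∃ L₂, L = L₁.reverse ++ L₂) → L₁.Nodup := by
    intro L₁
    induction L₁ with
    | nil => simp
    | cons i L₁ ih =>
      rintro ⟨L₂, h2⟩
      have h3 : L = L₁.reverse ++ i :: L₂ := by simpa using h2
      refine List.nodup_cons.2 ⟨?_, ih ⟨_, h3⟩⟩
      simpa using (h.1 _ _ _ h3).2.1
  exact key _ ⟨[], by simp⟩

theorem IsGreedyTrace.subset (h : IsGreedyTrace F c halt I L) : L.toFinset ⊆ I := by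
  intro i hi
  exact h.mem (by simpa using hi)

/-- Before the last item less than `B` has been spent, and that item costs at most `B`. -/
theorem IsGreedyTrace.sum_le {B : ℝ} (h : IsGreedyTrace F c (fun s => B ≤ s) I L) (hB : 0 ≤ B)
    (hI : ∀ i ∈ I, c i ≤ B) : (L.map c).sum ≤ 2 * B := by
  rcases List.eq_nil_or_concat' L with rfl | ⟨L₁, i, rfl⟩
  · simpa using hB
  · have h1 := h.1 L₁ i [] (by simp)
    have h2 := hI i h1.1
    have h3 := h1.2.2.1
    push Not at h3
    simp only [List.map_append, List.map_cons, List.map_nil, List.sum_append, List.sum_cons,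
      List.sum_nil]
    linarith

end Trace

/-! ## Monotone submodular set functions -/

/-- `F` is monotone and submodular on the subsets of `N`. -/
structure MonoSubmodularOn {n : ℕ} (N : Finset (Fin n)) (F : Finset (Fin n) → ℝ) : Prop where
  mono : ∀ R R' : Finset (Fin n), R ⊆ R' → R' ⊆ N → F R ≤ F R'
  submod : ∀ (R R' : Finset (Fin n)) (j : Fin n), R ⊆ R' → R' ⊆ N → j ∈ N →
    F (insert j R') - F R' ≤ F (insert j R) - F R

section Submodular

variable {n : ℕ} {N : Finset (Fin n)} {F : Finset (Fin n) → ℝ} {c : Fin n → ℝ}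

theorem MonoSubmodularOn.union_sub_le (hF : MonoSubmodularOn N F) {R P : Finset (Fin n)}
    (hR : R ⊆ N) (hP : P ⊆ N) :
    F (R ∪ P) - F R ≤ ∑ j ∈ P, (F (insert j R) - F R) := by
  induction P using Finset.induction_on with
  | empty => simp
  | insert j P hj ih =>
    rw [Finset.sum_insert hj, Finset.union_insert]
    have h1 := ih fun x hx => hP (Finset.mem_insert_of_mem hx)
    have h2 := hF.submod R (R ∪ P) j Finset.subset_union_left
      (Finset.union_subset hR fun x hx => hP (Finset.mem_insert_of_mem hx))
      (hP (Finset.mem_insert_self _ _))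
    linarith

/-- The score of a greedy choice bounds the average marginal value of any set of candidates. -/
theorem IsGreedyTrace.union_sub_le {halt : ℝ → Prop} {I : Finset (Fin n)} {L : List (Fin n)}
    (h : IsGreedyTrace F c halt I L) (hF : MonoSubmodularOn N F) (hI : I ⊆ N)
    (hc : ∀ i, 0 < c i) {L₁ : List (Fin n)} {i : Fin n} {L₂ : List (Fin n)}
    (hL : L = L₁ ++ i :: L₂) {P : Finset (Fin n)} (hP : P ⊆ I) :
    F (L₁.toFinset ∪ P) - F L₁.toFinset ≤
      (∑ j ∈ P, c j) * ((F (insert i L₁.toFinset) - F L₁.toFinset) / c i) := by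
  have h1 := h.1 _ _ _ hL
  have hR : L₁.toFinset ⊆ N := by
    intro x hx
    apply hI
    apply h.mem
    rw [hL]
    simp at hx
    simp [hx]
  have h0 : 0 ≤ (F (insert i L₁.toFinset) - F L₁.toFinset) / c i := by
    apply div_nonneg _ (hc i).le
    have := hF.mono L₁.toFinset (insert i L₁.toFinset) (Finset.subset_insert _ _)
      (Finset.insert_subset (hI h1.1) hR)
    linarith
  refine (hF.union_sub_le hR (hP.trans hI)).trans ?_
  rw [Finset.sum_mul]
  apply Finset.sum_le_sum
  intro j hj
  by_cases hj' : j ∈ L₁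
  · rw [Finset.insert_eq_of_mem (by simpa using hj')]
    have := mul_nonneg (hc j).le h0
    linarith
  · have := h1.2.2.2 j (hP hj) hj'
    rw [div_le_iff₀ (hc j)] at this
    linarith

/-! ## Wolsey's greedy algorithm -/

theorem exp_chi : Real.exp chi = 2 - chi := exists_chi.choose_spec

theorem chi_pos : 0 < chi := by
  by_contra h
  push Not at h
  have h1 := Real.exp_le_one_iff.2 h
  have := exp_chi
  linarith

theorem wolseyAlpha_pos : 0 < wolseyAlpha := by
  have : Real.exp (-chi) < 1 := Real.exp_lt_one_iff.2 (by linarith [chi_pos])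
  unfold wolseyAlpha
  linarith

/-- The equation defining χ balances the two outcomes of Wolsey's analysis: 1 - e^{-χ} is the value
of a run that has spent χB, and (1 - χ)e^{-χ} the marginal value of a last item of cost (1 - χ)B. -/
theorem wolseyAlpha_eq : wolseyAlpha = (1 - chi) * Real.exp (-chi) := by
  have h : Real.exp chi * Real.exp (-chi) = 1 := by rw [← Real.exp_add]; simp
  rw [exp_chi] at h
  unfold wolseyAlpha
  linarith

theorem wolseyAlpha_le_half : wolseyAlpha ≤ 1 / 2 := by
  have h := wolseyAlpha_eq
  have h2 : Real.exp chi * Real.exp (-chi) = 1 := by rw [← Real.exp_add]; simp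
  have h3 := Real.exp_pos (-chi)
  have h4 := chi_pos
  rw [exp_chi] at h2
  unfold wolseyAlpha at *
  nlinarith

/-- By `hstep`, an item of cost `c i` closes at least the fraction x = `c i / B` of the remaining
gap to `v`, and 1 - x ≤ e^{-x}. -/
theorem IsGreedyTrace.exp_le {halt : ℝ → Prop} {I : Finset (Fin n)} {L : List (Fin n)} {B v : ℝ}
    (h : IsGreedyTrace F c halt I L) (hc : ∀ i, 0 < c i) (hF0 : 0 ≤ F ∅) (hv : 0 ≤ v)
    (hI : ∀ i ∈ I, c i ≤ B)
    (hstep : ∀ L₁ i L₂, L = L₁ ++ i :: L₂ →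
      v - F L₁.toFinset ≤ B * ((F (insert i L₁.toFinset) - F L₁.toFinset) / c i))
    (L₁ L₂ : List (Fin n)) (hL : L = L₁ ++ L₂) :
    v * (1 - Real.exp (-((L₁.map c).sum / B))) ≤ F L₁.toFinset := by
  induction L₁ using List.reverseRecOn generalizing L₂ with
  | nil => simpa using hF0
  | append_singleton L₁ i ih =>
    have hL' : L = L₁ ++ i :: L₂ := by simpa using hL
    have h1 := ih _ hL'
    have h2 := hstep _ _ _ hL'
    have h3 := hI i (h.1 _ _ _ hL').1
    have hci := hc i
    have hB : 0 < B := hci.trans_le h3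
    have hs : (L₁ ++ [i]).toFinset = insert i L₁.toFinset := by ext x; simp
    rw [hs]
    simp only [List.map_append, List.map_cons, List.map_nil, List.sum_append, List.sum_cons,
      List.sum_nil, add_zero]
    rw [add_div, neg_add, Real.exp_add]
    set e := Real.exp (-((L₁.map c).sum / B))
    have he : 0 < e := Real.exp_pos _
    set x := c i / B with hx
    have hx1 : x ≤ 1 := (div_le_one hB).2 h3
    have hx2 : 1 - x ≤ Real.exp (-x) := by linarith [Real.add_one_le_exp (-x)]
    have h4 : x * (v - F L₁.toFinset) ≤ F (insert i L₁.toFinset) - F L₁.toFinset := by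
      have : x * (B * ((F (insert i L₁.toFinset) - F L₁.toFinset) / c i)) =
          F (insert i L₁.toFinset) - F L₁.toFinset := by
        rw [hx]; field_simp
      rw [← this]
      exact mul_le_mul_of_nonneg_left h2 (by positivity)
    have h5 : v * e * (1 - x) ≤ v * e * Real.exp (-x) :=
      mul_le_mul_of_nonneg_left hx2 (by positivity)
    have h6 : (1 - x) * (v * (1 - e)) ≤ (1 - x) * F L₁.toFinset :=
      mul_le_mul_of_nonneg_left h1 (by linarith)
    nlinarith

/-- If the items before the last are worth less than α F(P), they cost less than χB. A run that
overspends then ends with an item of cost at least (1 - χ)B, which alone is worth (1 - χ)e^{-χ} F(P)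
= α F(P). -/
theorem greedyTrace_wolsey_bound {I : Finset (Fin n)} {L₁ : List (Fin n)} {i : Fin n} {B : ℝ}
    (h : IsGreedyTrace F c (fun s => B < s) I (L₁ ++ [i])) (hF : MonoSubmodularOn N F)
    (hF0 : F ∅ = 0) (hIN : I ⊆ N) (hc : ∀ i, 0 < c i) (hI : ∀ i ∈ I, c i ≤ B)
    {P : Finset (Fin n)} (hP : P ⊆ I) (hPB : ∑ j ∈ P, c j ≤ B) :
    wolseyAlpha * F P ≤ max (F L₁.toFinset) (F {i}) := by
  set v := F P with hv
  have hv0 : 0 ≤ v := by rw [← hF0]; exact hF.mono _ _ (Finset.empty_subset _) (hP.trans hIN)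
  have hs : (L₁ ++ [i]).toFinset = insert i L₁.toFinset := by ext x; simp
  have hLN : insert i L₁.toFinset ⊆ N := by rw [← hs]; exact h.subset.trans hIN
  have hR : L₁.toFinset ⊆ N := (Finset.subset_insert _ _).trans hLN
  have hiI := h.mem (i := i) (by simp)
  have hstep : ∀ L' j L₂, L₁ ++ [i] = L' ++ j :: L₂ →
      v - F L'.toFinset ≤ B * ((F (insert j L'.toFinset) - F L'.toFinset) / c j) := by
    intro L' j L₂ hL
    have h1 := h.union_sub_le hF hIN hc hL hP
    have hsub : insert j L'.toFinset ⊆ N := by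
      refine Finset.Subset.trans ?_ (h.subset.trans hIN)
      rw [hL]; intro x hx; simp at hx ⊢; tauto
    have hsub' := (Finset.subset_insert j L'.toFinset).trans hsub
    have h2 := hF.mono P (L'.toFinset ∪ P) Finset.subset_union_right
      (Finset.union_subset hsub' (hP.trans hIN))
    have h3 := hF.mono _ _ (Finset.subset_insert j L'.toFinset) hsub
    have h4 : 0 ≤ (F (insert j L'.toFinset) - F L'.toFinset) / c j :=
      div_nonneg (by linarith) (hc j).le
    have := mul_le_mul_of_nonneg_right hPB h4
    linarith
  have hmarg : F (insert i L₁.toFinset) - F L₁.toFinset ≤ F {i} := by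
    have := hF.submod ∅ L₁.toFinset i (Finset.empty_subset _) hR (hIN hiI)
    simpa [hF0] using this
  rcases h.2 with hall | hhalt
  -- All candidates were taken, so F(P) ≤ F(`L₁`) + F({i}); the larger term is at least half, and α
  -- ≤ 1/2.
  · have h1 : v ≤ F (insert i L₁.toFinset) := by
      refine hF.mono _ _ (fun x hx => ?_) hLN
      rw [← hs]; exact List.mem_toFinset.2 (hall x (hP hx))
    have h2 := mul_le_mul_of_nonneg_right wolseyAlpha_le_half hv0
    rcases le_total (F L₁.toFinset) (F {i}) with h3 | h3
    · rw [max_eq_right h3]; linarith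
    · rw [max_eq_left h3]; linarith
  · by_cases hx : wolseyAlpha * v ≤ F L₁.toFinset
    · exact le_max_of_le_left hx
    · push Not at hx
      apply le_max_of_le_right
      have h1 := h.exp_le hc hF0.ge hv0 hI hstep L₁ [i] rfl
      have h2 := hstep L₁ i [] (by simp)
      have hci := hc i
      have hB : 0 < B := hci.trans_le (hI i hiI)
      simp only [List.map_append, List.map_cons, List.map_nil, List.sum_append, List.sum_cons,
        List.sum_nil, add_zero] at hhalt
      have hvpos : 0 < v := by
        rcases hv0.eq_or_lt with h0 | h0
        · rw [← h0] at hx h1; simp at hx h1; linarith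
        · exact h0
      have h3 : (L₁.map c).sum / B < chi := by
        have h4 : 1 - Real.exp (-((L₁.map c).sum / B)) < wolseyAlpha := by
          have := h1.trans_lt hx
          rw [mul_comm wolseyAlpha] at this
          exact lt_of_mul_lt_mul_left this hv0
        unfold wolseyAlpha at h4
        have h5 : Real.exp (-chi) < Real.exp (-((L₁.map c).sum / B)) := by linarith
        have := Real.exp_lt_exp.1 h5
        linarith
      have h4 : 1 - chi ≤ c i / B := by
        have : 1 < (L₁.map c).sum / B + c i / B := by
          rw [← add_div, lt_div_iff₀ hB]; linarith
        linarith
      have h5 : c i / B * (v - F L₁.toFinset) ≤ F (insert i L₁.toFinset) - F L₁.toFinset := by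
        have : c i / B * (B * ((F (insert i L₁.toFinset) - F L₁.toFinset) / c i)) =
            F (insert i L₁.toFinset) - F L₁.toFinset := by field_simp
        rw [← this]
        exact mul_le_mul_of_nonneg_left h2 (by positivity)
      have h6 : Real.exp (-chi) * v ≤ v - F L₁.toFinset := by
        unfold wolseyAlpha at hx; linarith
      have h7 : (1 - chi) * (Real.exp (-chi) * v) ≤ c i / B * (v - F L₁.toFinset) :=
        mul_le_mul h4 h6 (mul_nonneg (Real.exp_pos _).le hv0)
          (by positivity)
      have h8 := wolseyAlpha_eq
      have h9 : wolseyAlpha * v = (1 - chi) * (Real.exp (-chi) * v) := by rw [h8]; ring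
      linarith

theorem wolseyGreedy_value {pick : Finset (Fin n) → (Fin n → ℝ) → Fin n}
    (hp : IsArgmaxRule pick) (hF : MonoSubmodularOn N F) (hF0 : F ∅ = 0) (hc : ∀ i, 0 < c i)
    {B : ℝ} {P : Finset (Fin n)} (hP : P ⊆ N) (hPB : ∑ j ∈ P, c j ≤ B) :
    wolseyAlpha * F P ≤ F (wolseyGreedy pick N F c B) := by
  have h := greedyRun_isGreedyTrace hp F c (fun s => B < s) N B
  have hP' : P ⊆ N.filter fun i => c i ≤ B := by
    intro i hi
    rw [Finset.mem_filter]
    exact ⟨hP hi, (Finset.single_le_sum (fun j _ => (hc j).le) hi).trans hPB⟩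
  have hB : 0 ≤ B := (Finset.sum_nonneg fun j _ => (hc j).le).trans hPB
  unfold wolseyGreedy
  generalize greedyRun pick F c (fun s => B < s) N B = L at h
  rcases List.eq_nil_or_concat' L with rfl | ⟨L₁, i, rfl⟩
  · have hPe : P = ∅ := by
      rcases h.2 with h2 | h2
      · rw [Finset.eq_empty_iff_forall_notMem]
        intro x hx
        simpa using h2 x (hP' hx)
      · simp at h2; linarith
    simp [hPe, hF0]
  · have := greedyTrace_wolsey_bound h hF hF0 (Finset.filter_subset _ _) hc
      (fun i hi => (Finset.mem_filter.1 hi).2) hP' hPB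
    have hr : (L₁ ++ [i]).reverse = i :: L₁.reverse := by simp
    rw [hr]
    have ht : L₁.reverse.toFinset = L₁.toFinset := by ext; simp
    simp only [ht]
    split_ifs with h3
    · rwa [max_eq_right h3] at this
    · rwa [max_eq_left (not_le.1 h3).le] at this

theorem wolseyGreedy_subset_cost {pick : Finset (Fin n) → (Fin n → ℝ) → Fin n}
    (hp : IsArgmaxRule pick) (F : Finset (Fin n) → ℝ) {B : ℝ} (hB : 0 ≤ B) :
    wolseyGreedy pick N F c B ⊆ N ∧ ∑ j ∈ wolseyGreedy pick N F c B, c j ≤ B := by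
  have h := greedyRun_isGreedyTrace hp F c (fun s => B < s) N B
  unfold wolseyGreedy
  generalize greedyRun pick F c (fun s => B < s) N B = L at h
  rcases List.eq_nil_or_concat' L with rfl | ⟨L₁, i, rfl⟩
  · simpa using hB
  · have hr : (L₁ ++ [i]).reverse = i :: L₁.reverse := by simp
    rw [hr]
    have ht : L₁.reverse.toFinset = L₁.toFinset := by ext; simp
    simp only [ht]
    have h1 := h.1 L₁ i [] (by simp)
    have h2 := Finset.mem_filter.1 h1.1
    split_ifs with h3
    · simpa using h2
    · refine ⟨fun x hx => (Finset.mem_filter.1 (h.mem (i := x) ?_)).1, ?_⟩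
      · simp at hx; simp [hx]
      · have hn : L₁.Nodup := (List.nodup_append.1 h.nodup).1
        rw [List.sum_toFinset c hn]
        exact not_lt.1 h1.2.2.1

/-- The cost of `P` is itself an admissible budget. -/
theorem findBudget_le {pick : Finset (Fin n) → (Fin n → ℝ) → Fin n}
    (hp : IsArgmaxRule pick) (hF : MonoSubmodularOn N F) (hF0 : F ∅ = 0) (hc : ∀ i, 0 < c i)
    {P : Finset (Fin n)} (hP : P ⊆ N) (hPN : F P = F N) :
    findBudget pick N F c ≤ ∑ j ∈ P, c j := by
  apply csInf_le ⟨0, fun x hx => hx.1⟩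
  refine ⟨Finset.sum_nonneg fun j _ => (hc j).le,
    Finset.sum_le_sum_of_subset_of_nonneg hP fun j _ _ => (hc j).le, ?_⟩
  rw [← hPN]
  exact wolseyGreedy_value hp hF hF0 hc hP le_rfl

/-- Whether the infimum is attained does not matter: take the cheapest of the finitely many sets of
value at least α F(N). Every admissible budget buys one of them, so its cost is a lower bound of the
budgets. -/
theorem exists_subset_findBudget {pick : Finset (Fin n) → (Fin n → ℝ) → Fin n}
    (hp : IsArgmaxRule pick) (hF : MonoSubmodularOn N F) (hF0 : F ∅ = 0) (hc : ∀ i, 0 < c i) :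
    ∃ Z ⊆ N, ∑ j ∈ Z, c j ≤ findBudget pick N F c ∧ wolseyAlpha * F N ≤ F Z := by
  classical
  have hN : wolseyAlpha * F N ≤ F N := by
    have h0 : 0 ≤ F N := by rw [← hF0]; exact hF.mono _ _ (Finset.empty_subset _) le_rfl
    nlinarith [wolseyAlpha_le_half]
  obtain ⟨Z, hZ, hmin⟩ := (N.powerset.filter fun Z => wolseyAlpha * F N ≤ F Z).exists_min_image
    (fun Z => ∑ j ∈ Z, c j) ⟨N, by simpa using hN⟩
  rw [Finset.mem_filter, Finset.mem_powerset] at hZ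
  refine ⟨Z, hZ.1, ?_, hZ.2⟩
  apply le_csInf
  · exact ⟨∑ i ∈ N, c i, Finset.sum_nonneg fun j _ => (hc j).le, le_rfl,
      wolseyGreedy_value hp hF hF0 hc le_rfl le_rfl⟩
  · rintro B ⟨hB, -, hv⟩
    have h1 := wolseyGreedy_subset_cost (N := N) (c := c) hp F hB
    exact (hmin _ (by simpa using ⟨h1.1, hv⟩)).trans h1.2

/-- A greedy run that spends at least `B` closes half of the gap to any set of cost at
most `B`. -/
theorem IsGreedyTrace.half_le {I : Finset (Fin n)} {L : List (Fin n)} {B v : ℝ}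
    (h : IsGreedyTrace F c (fun s => B ≤ s) I L) (hF : MonoSubmodularOn N F) (hIN : I ⊆ N)
    (hc : ∀ i, 0 < c i) (hB : 0 < B) {P : Finset (Fin n)} (hP : P ⊆ I)
    (hPB : ∑ j ∈ P, c j ≤ B) (hv : v ≤ F P) : (v + F ∅) / 2 ≤ F L.toFinset := by
  have hLN := h.subset.trans hIN
  by_cases hx : v ≤ F L.toFinset
  · have := hF.mono ∅ L.toFinset (Finset.empty_subset _) hLN
    linarith
  push Not at hx
  -- Throughout the run the gap to `v` is at least its final size, so every item gains at least (v -
  -- F(L))/B per unit cost. Spending `B` then gives v - F(L) ≤ F(L) - F(∅).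
  have key : ∀ L₁ L₂, L = L₁ ++ L₂ →
      (L₁.map c).sum * (v - F L.toFinset) ≤ B * (F L₁.toFinset - F ∅) := by
    intro L₁
    induction L₁ using List.reverseRecOn with
    | nil => intro L₂ _; simp
    | append_singleton L₁ i ih =>
      intro L₂ hL
      have hL' : L = L₁ ++ i :: L₂ := by simpa using hL
      have h1 := ih _ hL'
      have h2 := h.union_sub_le hF hIN hc hL' hP
      have hs : (L₁ ++ [i]).toFinset = insert i L₁.toFinset := by ext x; simp
      have hsub : insert i L₁.toFinset ⊆ L.toFinset := by
        rw [hL']; intro x hx; simp at hx ⊢; tauto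
      have hsub' := (Finset.subset_insert i L₁.toFinset).trans hsub
      have h3 := hF.mono P (L₁.toFinset ∪ P) Finset.subset_union_right
        (Finset.union_subset (hsub'.trans hLN) (hP.trans hIN))
      have h4 := hF.mono _ _ (Finset.subset_insert i L₁.toFinset) (hsub.trans hLN)
      have h5 := hF.mono _ _ hsub' hLN
      rw [hs]
      simp only [List.map_append, List.map_cons, List.map_nil, List.sum_append, List.sum_cons,
        List.sum_nil, add_zero]
      have hci := hc i
      have h6 : 0 ≤ (F (insert i L₁.toFinset) - F L₁.toFinset) / c i :=
        div_nonneg (by linarith) hci.le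
      have h7 := mul_le_mul_of_nonneg_right hPB h6
      have h8 : v - F L.toFinset ≤ B * ((F (insert i L₁.toFinset) - F L₁.toFinset) / c i) := by
        linarith
      have h9 := mul_le_mul_of_nonneg_left h8 hci.le
      have h10 : c i * (B * ((F (insert i L₁.toFinset) - F L₁.toFinset) / c i)) =
          B * (F (insert i L₁.toFinset) - F L₁.toFinset) := by field_simp
      rw [h10] at h9
      nlinarith
  rcases h.2 with hall | hhalt
  · have := hF.mono P L.toFinset (fun x hx => by simpa using hall x (hP hx)) hLN
    linarith
  · have h1 := key L [] (by simp)
    have h2 := mul_le_mul_of_nonneg_right hhalt (by linarith : 0 ≤ v - F L.toFinset)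
    have h3 := le_of_mul_le_mul_left (h2.trans h1) hB
    linarith

end Submodular

/-! ## The utility of a `k`-of-`n` function -/

theorem countState_le_of_extends {n : ℕ} {b b' : PartialReal n Bool} (h : Extends b' b)
    (γ : Bool) : countState γ b ≤ countState γ b' := by
  apply Finset.card_le_card
  intro i hi
  simp only [Finset.mem_filter, Finset.mem_univ, true_and] at hi ⊢
  rw [h i (by simp [hi]), hi]

theorem countState_setState {n : ℕ} {b : PartialReal n Bool} {i : Fin n} (hi : b i = none)
    (γ γ' : Bool) :
    countState γ' (setState b i γ) = countState γ' b + if γ = γ' then 1 else 0 := by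
  unfold countState setState
  split_ifs with h
  · have : (Finset.univ.filter fun j => Function.update b i (some γ) j = some γ') =
        insert i (Finset.univ.filter fun j => b j = some γ') := by
      ext j
      by_cases hj : j = i
      · subst hj; simp [h]
      · simp [hj]
    rw [this, Finset.card_insert_of_notMem (by simp [hi])]
  · rw [add_zero]
    congr 1
    ext j
    by_cases hj : j = i
    · subst hj; simp [h, hi]
    · simp [hj]

theorem countState_fullReal {n : ℕ} (a : Fin n → Bool) :
    countState false (fullReal a) + countState true (fullReal a) = n := by
  unfold countState fullReal
  have := Finset.card_filter_add_card_filter_not (s := (Finset.univ : Finset (Fin n)))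
    (fun i => a i = false)
  simpa using this

/-- The distance of a partial realization from the goal value. -/
def kOfNGap (n k : ℕ) (b : PartialReal n Bool) : ℕ :=
  (n - k + 1 - countState false b) * (k - countState true b)

theorem kOfNUtility_eq (n k : ℕ) (b : PartialReal n Bool) :
    kOfNUtility n k b = kOfNGoal n k - kOfNGap n k b := by
  unfold kOfNUtility orCombine kOfNGoal kOfNGap
  have h1 : n - k + 1 - min (n - k + 1) (countState false b) = n - k + 1 - countState false b := by
    omega
  have h2 : k - min k (countState true b) = k - countState true b := by omega
  simp only [h1, h2, mul_comm]

theorem kOfNGap_le (n k : ℕ) (b : PartialReal n Bool) : kOfNGap n k b ≤ kOfNGoal n k := by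
  unfold kOfNGap kOfNGoal
  rw [mul_comm k]
  exact Nat.mul_le_mul (by omega) (by omega)

theorem kOfNUtility_cast (n k : ℕ) (b : PartialReal n Bool) :
    (kOfNUtility n k b : ℝ) = kOfNGoal n k - kOfNGap n k b := by
  rw [kOfNUtility_eq, Nat.cast_sub (kOfNGap_le n k b)]

theorem kOfNGap_eq_zero {n k : ℕ} {b : PartialReal n Bool} :
    kOfNGap n k b = 0 ↔ n - k + 1 ≤ countState false b ∨ k ≤ countState true b := by
  unfold kOfNGap
  rw [Nat.mul_eq_zero]
  omega

theorem kOfNUtility_eq_goal_iff_gap {n k : ℕ} {b : PartialReal n Bool} :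
    kOfNUtility n k b = kOfNGoal n k ↔ kOfNGap n k b = 0 := by
  have h1 := kOfNUtility_eq n k b
  have h2 := kOfNGap_le n k b
  constructor
  · intro h
    by_cases hk : k = 0
    · subst hk; simp [kOfNGap]
    · have : 0 < kOfNGoal n k := Nat.mul_pos (by omega) (by omega)
      omega
  · intro h; omega

theorem kOfNGap_antitone {n k : ℕ} {b b' : PartialReal n Bool} (h : Extends b' b) :
    kOfNGap n k b' ≤ kOfNGap n k b := by
  have h1 := countState_le_of_extends h true
  have h2 := countState_le_of_extends h false
  exact Nat.mul_le_mul (by omega) (by omega)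

theorem kOfNUtility_mono {n k : ℕ} {b b' : PartialReal n Bool} (h : Extends b' b) :
    kOfNUtility n k b ≤ kOfNUtility n k b' := by
  rw [kOfNUtility_eq, kOfNUtility_eq]
  have := kOfNGap_antitone (k := k) h
  omega

theorem extends_setState {n : ℕ} {b : PartialReal n Bool} {i : Fin n} (hi : b i = none)
    (γ : Bool) : Extends (setState b i γ) b := by
  intro j hj
  have : j ≠ i := by rintro rfl; exact hj hi
  simp [setState, this]

theorem Extends.trans {n : ℕ} {b₁ b₂ b₃ : PartialReal n Bool} (h : Extends b₁ b₂)
    (h' : Extends b₂ b₃) : Extends b₁ b₃ := by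
  intro i hi
  rw [h i (by rw [h' i hi]; exact hi), h' i hi]

theorem gain_kOfNUtility_true {n k : ℕ} {b : PartialReal n Bool} {i : Fin n} (hi : b i = none) :
    gain (kOfNUtility n k) b i true =
      (n - k + 1 - countState false b : ℕ) * (min 1 (k - countState true b) : ℕ) := by
  unfold gain
  rw [kOfNUtility_cast, kOfNUtility_cast]
  unfold kOfNGap
  rw [countState_setState hi, countState_setState hi]
  simp only [Bool.true_eq_false, if_false, if_true, add_zero]
  have h : k - countState true b = (k - (countState true b + 1)) + min 1 (k - countState true b) :=
    by omega
  have h' : ((k - countState true b : ℕ) : ℝ) =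
      (k - (countState true b + 1) : ℕ) + (min 1 (k - countState true b) : ℕ) := by
    exact_mod_cast h
  push_cast only [Nat.cast_mul]
  rw [h']
  ring

theorem gain_kOfNUtility_false {n k : ℕ} {b : PartialReal n Bool} {i : Fin n} (hi : b i = none) :
    gain (kOfNUtility n k) b i false =
      (min 1 (n - k + 1 - countState false b) : ℕ) * (k - countState true b : ℕ) := by
  unfold gain
  rw [kOfNUtility_cast, kOfNUtility_cast]
  unfold kOfNGap
  rw [countState_setState hi, countState_setState hi]
  simp only [Bool.false_eq_true, if_false, if_true, add_zero]
  set z := countState false b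
  have h : n - k + 1 - z = (n - k + 1 - (z + 1)) + min 1 (n - k + 1 - z) := by omega
  have h' : ((n - k + 1 - z : ℕ) : ℝ) =
      (n - k + 1 - (z + 1) : ℕ) + (min 1 (n - k + 1 - z) : ℕ) := by
    exact_mod_cast h
  push_cast only [Nat.cast_mul]
  rw [h']
  ring

theorem kOfNUtility_monotone (n k : ℕ) : UtilityMonotone (kOfNUtility n k) :=
  fun _ _ γ hi => kOfNUtility_mono (extends_setState hi γ)

theorem gain_kOfNUtility_anti {n k : ℕ} {b b' : PartialReal n Bool} {i : Fin n} (γ : Bool)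
    (h : Extends b' b) (hi : b i = none) (hi' : b' i = none) :
    gain (kOfNUtility n k) b' i γ ≤ gain (kOfNUtility n k) b i γ := by
  have h1 := countState_le_of_extends h true
  have h2 := countState_le_of_extends h false
  cases γ
  · rw [gain_kOfNUtility_false hi, gain_kOfNUtility_false hi']
    exact_mod_cast Nat.mul_le_mul (by omega) (by omega)
  · rw [gain_kOfNUtility_true hi, gain_kOfNUtility_true hi']
    exact_mod_cast Nat.mul_le_mul (by omega) (by omega)

theorem kOfNUtility_submodular (n k : ℕ) : UtilitySubmodular (kOfNUtility n k) :=
  fun _ _ _ γ h _ hi hi' => gain_kOfNUtility_anti γ h hi hi'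

theorem kOfNUtility_eq_goal_iff (n k : ℕ) (b : PartialReal n Bool) :
    kOfNUtility n k b = kOfNGoal n k ↔
      (n - k + 1 ≤ countState false b ∨ k ≤ countState true b) :=
  kOfNUtility_eq_goal_iff_gap.trans kOfNGap_eq_zero

theorem kOfNUtility_hasGoalValue {n k : ℕ} (hkn : k ≤ n) :
    HasGoalValue (kOfNUtility n k) (kOfNGoal n k) := by
  intro a
  rw [kOfNUtility_eq_goal_iff]
  have := countState_fullReal a
  omega

/-- A state that is not the worst case closes a fraction `1 / k` of the gap. -/
theorem gap_le_mul_gain {n k : ℕ} {wc : PartialReal n Bool → Fin n → Bool}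
    (hwc : IsWorstCase (kOfNUtility n k) wc) {b : PartialReal n Bool} {i : Fin n} {γ : Bool}
    (hi : b i = none) (hγ : γ ≠ wc b i) :
    (kOfNGap n k b : ℝ) ≤ k * gain (kOfNUtility n k) b i γ := by
  -- With only two states, the one that is not the minimizer has the maximal gain.
  have h1 : gain (kOfNUtility n k) b i true ≤ gain (kOfNUtility n k) b i γ ∧
      gain (kOfNUtility n k) b i false ≤ gain (kOfNUtility n k) b i γ := by
    have h := hwc b i hi γ
    cases γ <;> cases hw : wc b i <;> simp_all
  have h2 := h1.1
  rw [gain_kOfNUtility_true hi] at h2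
  refine le_trans ?_ (mul_le_mul_of_nonneg_left h2 (Nat.cast_nonneg k))
  unfold kOfNGap
  set q := k - countState true b with hq
  have : (n - k + 1 - countState false b) * q ≤
      k * ((n - k + 1 - countState false b) * min 1 q) := by
    have hqk : q ≤ k * min 1 q := by
      rcases Nat.eq_zero_or_pos q with h0 | h0
      · simp [h0]
      · rw [min_eq_left h0]; omega
    calc (n - k + 1 - countState false b) * q
        ≤ (n - k + 1 - countState false b) * (k * min 1 q) := Nat.mul_le_mul_left _ hqk
      _ = _ := by ring
  exact_mod_cast this

theorem exists_isRho {n k : ℕ} (hkn : k ≤ n) (hk : 1 ≤ k)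
    {wc : PartialReal n Bool → Fin n → Bool} (hwc : IsWorstCase (kOfNUtility n k) wc) :
    ∃ ρ : ℝ, IsRho (kOfNUtility n k) (kOfNGoal n k) wc ρ ∧ 1 / (k : ℝ) ≤ ρ := by
  set A : Set ℝ := {r : ℝ | ∃ (b : PartialReal n Bool) (i : Fin n) (γ : Bool),
    kOfNUtility n k b < kOfNGoal n k ∧ b i = none ∧ γ ≠ wc b i ∧
      r = gain (kOfNUtility n k) b i γ / ((kOfNGoal n k : ℝ) - (kOfNUtility n k b : ℝ))} with hA
  have hfin : A.Finite := by
    refine (Set.finite_range fun x : PartialReal n Bool × Fin n × Bool =>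
      gain (kOfNUtility n k) x.1 x.2.1 x.2.2 /
        ((kOfNGoal n k : ℝ) - (kOfNUtility n k x.1 : ℝ))).subset ?_
    rintro r ⟨b, i, γ, -, -, -, rfl⟩
    exact ⟨(b, i, γ), rfl⟩
  have hne : A.Nonempty := by
    let b : PartialReal n Bool := fun _ => none
    let i : Fin n := ⟨0, by omega⟩
    refine ⟨_, b, i, !(wc b i), ?_, rfl, by simp, rfl⟩
    refine lt_of_le_of_ne ((kOfNUtility_eq n k b).le.trans (Nat.sub_le _ _)) ?_
    rw [Ne, kOfNUtility_eq_goal_iff]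
    simp [countState, b]
    omega
  obtain ⟨ρ, hρ⟩ := hfin.exists_minimal hne
  have hleast : IsLeast A ρ := by
    refine ⟨hρ.1, fun r hr => ?_⟩
    rcases le_total ρ r with h | h
    · exact h
    · exact hρ.2 hr h
  refine ⟨ρ, hleast, ?_⟩
  obtain ⟨b, i, γ, hb, hi, hγ, rfl⟩ := hleast.1
  have h1 := gap_le_mul_gain hwc hi hγ
  have h2 : (0 : ℝ) < kOfNGoal n k - kOfNUtility n k b := by
    have : (kOfNUtility n k b : ℝ) < kOfNGoal n k := by exact_mod_cast hb
    linarith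
  have h3 : (0 : ℝ) < k := by exact_mod_cast hk
  rw [div_le_div_iff₀ h3 h2, kOfNUtility_cast]
  linarith

/-! ## The utility as a set function -/

/-- The set of undetermined items. -/
def undet {n : ℕ} (b : PartialReal n Bool) : Finset (Fin n) :=
  Finset.univ.filter fun i => b i = none

theorem mem_undet {n : ℕ} {b : PartialReal n Bool} {i : Fin n} : i ∈ undet b ↔ b i = none := by
  simp [undet]

theorem setStates_empty {n : ℕ} (b : PartialReal n Bool) (σ : Fin n → Bool) :
    setStates b σ ∅ = b := by
  funext i; simp [setStates]

theorem setStates_insert {n : ℕ} (b : PartialReal n Bool) (σ : Fin n → Bool) (i : Fin n)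
    (U : Finset (Fin n)) : setStates b σ (insert i U) = setState (setStates b σ U) i (σ i) := by
  funext j
  by_cases hj : j = i
  · subst hj; simp [setStates, setState]
  · simp [setStates, setState, hj]

theorem setStates_setState {n : ℕ} (b : PartialReal n Bool) (σ : Fin n → Bool) (i : Fin n)
    (U : Finset (Fin n)) : setStates (setState b i (σ i)) σ U = setStates b σ (insert i U) := by
  funext j
  by_cases hj : j = i
  · subst hj; simp [setStates, setState]
  · simp [setStates, setState, hj]

theorem extends_setStates {n : ℕ} {b : PartialReal n Bool} {σ : Fin n → Bool}
    {R R' : Finset (Fin n)} (h : R ⊆ R') (hR' : R' ⊆ undet b) :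
    Extends (setStates b σ R') (setStates b σ R) := by
  intro j hj
  by_cases h1 : j ∈ R
  · simp [setStates, h1, h h1]
  · by_cases h2 : j ∈ R'
    · have := mem_undet.1 (hR' h2)
      simp [setStates, h1, this] at hj
    · simp [setStates, h1, h2]

theorem setStates_undet {n : ℕ} (b : PartialReal n Bool) (σ : Fin n → Bool) :
    setStates b σ (undet b) = fullReal fun i => (b i).getD (σ i) := by
  funext i
  cases h : b i <;> simp [setStates, fullReal, mem_undet, h]

theorem monoSubmodularOn_setStates {n : ℕ} (k : ℕ) (b : PartialReal n Bool) (σ : Fin n → Bool)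
    (x : ℝ) {Y : Finset (Fin n)} (hY : Y ⊆ undet b) :
    MonoSubmodularOn (undet b) fun U => (kOfNUtility n k (setStates b σ (Y ∪ U)) : ℝ) - x where
  mono R R' h h' := by
    have := kOfNUtility_mono (k := k) (extends_setStates (σ := σ)
      (Finset.union_subset_union_right (s := Y) h) (Finset.union_subset hY h'))
    have : (kOfNUtility n k (setStates b σ (Y ∪ R)) : ℝ) ≤
      kOfNUtility n k (setStates b σ (Y ∪ R')) := by exact_mod_cast this
    linarith
  submod R R' j h h' hj := by
    have hsub := Finset.union_subset_union_right (s := Y) h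
    have hsub' := Finset.union_subset hY h'
    rw [Finset.union_insert, Finset.union_insert]
    -- An item already present has marginal value zero, so only monotonicity is needed; otherwise it
    -- is undetermined in both partial realizations.
    by_cases h1 : j ∈ Y ∪ R'
    · rw [Finset.insert_eq_of_mem h1]
      have h2 : insert j (Y ∪ R) ⊆ undet b := Finset.insert_subset hj (hsub.trans hsub')
      have := kOfNUtility_mono (k := k) (extends_setStates (σ := σ)
        (Finset.subset_insert j (Y ∪ R)) h2)
      have : (kOfNUtility n k (setStates b σ (Y ∪ R)) : ℝ) ≤
        kOfNUtility n k (setStates b σ (insert j (Y ∪ R))) := by exact_mod_cast this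
      linarith
    · have h2 : j ∉ Y ∪ R := fun h => h1 (hsub h)
      have hb := mem_undet.1 hj
      have := gain_kOfNUtility_anti (k := k) (i := j) (σ j)
        (extends_setStates (σ := σ) hsub hsub') (by simp only [setStates, h2, if_false, hb])
        (by simp only [setStates, h1, if_false, hb])
      unfold gain at this
      rw [setStates_insert, setStates_insert]
      linarith

/-! ## Min-sum set cover: the greedy order against an arbitrary order -/

/-- Sum of `f i R` along a list, where `R` is the set of items met before `i`. -/
def traceSum {n : ℕ} (f : Fin n → Finset (Fin n) → ℝ) : List (Fin n) → Finset (Fin n) → ℝ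
  | [], _ => 0
  | i :: L, R => f i R + traceSum f L (insert i R)

theorem traceSum_mono {n : ℕ} {f g : Fin n → Finset (Fin n) → ℝ} (h : ∀ i R, f i R ≤ g i R)
    (L : List (Fin n)) (R : Finset (Fin n)) : traceSum f L R ≤ traceSum g L R := by
  induction L generalizing R with
  | nil => exact le_rfl
  | cons i L ih => exact add_le_add (h i R) (ih _)

theorem traceSum_add_mul {n : ℕ} (f g : Fin n → Finset (Fin n) → ℝ) (x : ℝ)
    (L : List (Fin n)) (R : Finset (Fin n)) :
    traceSum (fun i R => f i R + x * g i R) L R = traceSum f L R + x * traceSum g L R := by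
  induction L generalizing R with
  | nil => simp [traceSum]
  | cons i L ih => simp only [traceSum, ih]; ring

theorem traceSum_append {n : ℕ} (f : Fin n → Finset (Fin n) → ℝ) (L L' : List (Fin n))
    (R : Finset (Fin n)) :
    traceSum f (L ++ L') R = traceSum f L R + traceSum f L' (R ∪ L.toFinset) := by
  induction L generalizing R with
  | nil => simp [traceSum]
  | cons i L ih =>
    have : insert i R ∪ L.toFinset = R ∪ (i :: L).toFinset := by
      ext x; simp
    simp only [List.cons_append, traceSum, ih, this]
    ring

theorem traceSum_telescope {n : ℕ} (G : Finset (Fin n) → ℝ) (L : List (Fin n))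
    (R : Finset (Fin n)) :
    traceSum (fun i R => G R - G (insert i R)) L R = G R - G (R ∪ L.toFinset) := by
  induction L generalizing R with
  | nil => simp [traceSum]
  | cons i L ih =>
    have : insert i R ∪ L.toFinset = R ∪ (i :: L).toFinset := by
      ext x; simp
    simp only [traceSum, ih, this]
    ring

theorem traceSum_mul_le {n : ℕ} {c : Fin n → ℝ} (hc : ∀ i, 0 < c i) {G : Finset (Fin n) → ℝ}
    (hG : Antitone G) (L : List (Fin n)) (R : Finset (Fin n)) :
    traceSum (fun i R => c i * G R) L R ≤ (L.map c).sum * G R := by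
  induction L generalizing R with
  | nil => simp [traceSum]
  | cons i L ih =>
    have h1 := ih (insert i R)
    have h2 : 0 ≤ (L.map c).sum := List.sum_nonneg (by
      intro x hx; obtain ⟨j, -, rfl⟩ := List.mem_map.1 hx; exact (hc j).le)
    have h3 := mul_le_mul_of_nonneg_left (hG (Finset.subset_insert i R)) h2
    simp only [traceSum, List.map_cons, List.sum_cons]
    linarith

theorem le_traceSum_mul {n : ℕ} {c : Fin n → ℝ} (hc : ∀ i, 0 < c i) {G : Finset (Fin n) → ℝ}
    (hG : Antitone G) (L : List (Fin n)) (R : Finset (Fin n)) :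
    (L.map c).sum * G (R ∪ L.toFinset) ≤ traceSum (fun i R => c i * G R) L R := by
  induction L generalizing R with
  | nil => simp [traceSum]
  | cons i L ih =>
    have : insert i R ∪ L.toFinset = R ∪ (i :: L).toFinset := by
      ext x; simp
    have h1 := ih (insert i R)
    rw [this] at h1
    have h3 := mul_le_mul_of_nonneg_left
      (hG (Finset.subset_union_left : R ⊆ R ∪ (i :: L).toFinset)) (hc i).le
    simp only [traceSum, List.map_cons, List.sum_cons]
    linarith

open Classical in
/-- The total weight of the elements of `A` that no item of `R` covers. -/
def uncovered {n : ℕ} {α : Type} (A : Finset α) (w : α → ℝ) (cov : Fin n → α → Prop)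
    (R : Finset (Fin n)) : ℝ :=
  ∑ a ∈ A.filter (fun a => ∀ i ∈ R, ¬ cov i a), w a

section Uncovered

variable {n : ℕ} {α : Type} {A : Finset α} {w : α → ℝ} {cov : Fin n → α → Prop}

theorem uncovered_nonneg (hw : ∀ a, 0 ≤ w a) (R : Finset (Fin n)) : 0 ≤ uncovered A w cov R :=
  Finset.sum_nonneg fun a _ => hw a

theorem uncovered_antitone (hw : ∀ a, 0 ≤ w a) : Antitone (uncovered A w cov) := by
  classical
  intro R R' h
  refine Finset.sum_le_sum_of_subset_of_nonneg ?_ fun a _ _ => hw a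
  intro a ha
  simp only [Finset.mem_filter] at ha ⊢
  exact ⟨ha.1, fun i hi => ha.2 i (h hi)⟩

theorem uncovered_sub_insert (R : Finset (Fin n)) (j : Fin n) [DecidablePred fun a =>
    (∀ i ∈ R, ¬ cov i a) ∧ cov j a] :
    uncovered A w cov R - uncovered A w cov (insert j R) =
      ∑ a ∈ A.filter (fun a => (∀ i ∈ R, ¬ cov i a) ∧ cov j a), w a := by
  classical
  rw [sub_eq_iff_eq_add]
  unfold uncovered
  simp only [Finset.sum_filter, ← Finset.sum_add_distrib]
  apply Finset.sum_congr rfl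
  intro a _
  by_cases h1 : ∀ i ∈ R, ¬ cov i a <;> by_cases h2 : cov j a <;> simp [h1, h2]

/-- The constant `x` is free because only differences matter; the weight removed by the first stage
is the case where `x` is the total consistent weight. -/
theorem monoSubmodularOn_covered (hw : ∀ a, 0 ≤ w a) (x : ℝ) (N : Finset (Fin n)) :
    MonoSubmodularOn N fun R => x - uncovered A w cov R where
  mono R R' h _ := by
    have := uncovered_antitone (A := A) (cov := cov) hw h
    linarith
  submod R R' j h _ _ := by
    classical
    have h1 := uncovered_sub_insert (A := A) (w := w) (cov := cov) R j
    have h2 := uncovered_sub_insert (A := A) (w := w) (cov := cov) R' j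
    have : ∑ a ∈ A.filter (fun a => (∀ i ∈ R', ¬ cov i a) ∧ cov j a), w a ≤
        ∑ a ∈ A.filter (fun a => (∀ i ∈ R, ¬ cov i a) ∧ cov j a), w a := by
      refine Finset.sum_le_sum_of_subset_of_nonneg ?_ fun a _ _ => hw a
      intro a ha
      simp only [Finset.mem_filter] at ha ⊢
      exact ⟨ha.1, fun i hi => ha.2.1 i (h hi), ha.2.2⟩
    linarith

/-- If few of the elements not covered by `R` have `θ a < t`, then many of them pay at
least `t`. -/
theorem half_uncovered_le {θ : α → ℝ} (hw : ∀ a, 0 ≤ w a) {P R : Finset (Fin n)} {t : ℝ}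
    (hP : ∀ a ∈ A, θ a < t → ∃ i ∈ P, cov i a)
    (h : uncovered A w cov R - uncovered A w cov (R ∪ P) ≤ uncovered A w cov R / 2)
    [DecidablePred fun a => t ≤ θ a] :
    uncovered A w cov R ≤ 2 * ∑ a ∈ A.filter (fun a => t ≤ θ a), w a := by
  classical
  have : uncovered A w cov (R ∪ P) ≤ ∑ a ∈ A.filter (fun a => t ≤ θ a), w a := by
    refine Finset.sum_le_sum_of_subset_of_nonneg ?_ fun a _ _ => hw a
    intro a ha
    simp only [Finset.mem_filter] at ha ⊢
    refine ⟨ha.1, ?_⟩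
    by_contra hlt
    obtain ⟨i, hi, hci⟩ := hP a ha.1 (not_le.1 hlt)
    exact ha.2 i (Finset.mem_union_right _ hi) hci
  linarith

/-- A pricing argument for min-sum set cover. With G(R) the uncovered weight, a step pays c_i G(R),
that is, the price p = c_i G(R)/gain per unit of newly covered weight; the sum bounded here is that
of gain · max(0, p - τ). If p ≤ 2B, the alternative set available at time p/2 covers at most half of
G(R) by greediness, so at least half of G(R) has θ ≥ p/2. Raising the threshold τ to p during the
induction turns this into a comparison of the two price distributions. The term 4 ∑ w θ pays for the
tail of the run once the price reaches 2B. -/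
theorem greedy_minSum_aux {c : Fin n → ℝ} {I : Finset (Fin n)} {L : List (Fin n)} {B x : ℝ}
    {θ : α → ℝ} (hw : ∀ a, 0 ≤ w a) (hθ : ∀ a, 0 ≤ θ a) (hB : 0 < B) (hc : ∀ i, 0 < c i)
    (hI : ∀ i ∈ I, c i ≤ B)
    (h : IsGreedyTrace (fun R => x - uncovered A w cov R) c (fun s => B ≤ s) I L)
    (hP : ∀ t, 0 ≤ t → t ≤ B → ∃ P ⊆ I, ∑ j ∈ P, c j ≤ t ∧
      ∀ a ∈ A, θ a < t → ∃ i ∈ P, cov i a)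
    (L₁ L₂ : List (Fin n)) (hL : L = L₁ ++ L₂) (τ : ℝ) (hτ : 0 ≤ τ) :
    traceSum (fun i R => max 0 (c i * uncovered A w cov R -
      τ * (uncovered A w cov R - uncovered A w cov (insert i R)))) L₂ L₁.toFinset ≤
      4 * ∑ a ∈ A, w a * max 0 (θ a - τ / 2) + 4 * ∑ a ∈ A, w a * θ a := by
  classical
  set G := uncovered A w cov with hG
  have hG0 : ∀ R, 0 ≤ G R := uncovered_nonneg hw
  have hGa : Antitone G := uncovered_antitone hw
  have hins : ∀ i R, 0 ≤ G R - G (insert i R) := fun i R =>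
    sub_nonneg.2 (hGa (Finset.subset_insert i R))
  have hpos : ∀ τ, 0 ≤ 4 * ∑ a ∈ A, w a * max 0 (θ a - τ / 2) := fun τ =>
    mul_nonneg (by norm_num) (Finset.sum_nonneg fun a _ => mul_nonneg (hw a) (le_max_left _ _))
  have hpos' : 0 ≤ 4 * ∑ a ∈ A, w a * θ a :=
    mul_nonneg (by norm_num) (Finset.sum_nonneg fun a _ => mul_nonneg (hw a) (hθ a))
  induction L₂ generalizing L₁ τ with
  | nil => simp only [traceSum]; linarith [hpos τ]
  | cons i L₂ ih =>
    set R := L₁.toFinset with hR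
    set gainR := G R - G (insert i R) with hgain
    have hstep : ∀ P ⊆ I, G R - G (R ∪ P) ≤ (∑ j ∈ P, c j) * (gainR / c i) := by
      intro P hPI
      have := h.union_sub_le (monoSubmodularOn_covered hw x Finset.univ)
        (Finset.subset_univ _) hc hL hPI
      simp only [← hR] at this
      have e : x - G (insert i R) - (x - G R) = gainR := by rw [hgain]; ring
      rw [e] at this
      linarith
    have hci := hc i
    have hg0 : 0 ≤ gainR := hins i R
    have hr0 : 0 ≤ gainR / c i := div_nonneg hg0 hci.le
    -- Applied twice: with t = B when the price is at least 2B, and with t = p/2 otherwise.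
    have hhalf : ∀ t, 0 ≤ t → t ≤ B → t * (gainR / c i) ≤ G R / 2 →
        G R ≤ 2 * ∑ a ∈ A.filter (fun a => t ≤ θ a), w a := by
      intro t ht htB hle
      obtain ⟨P, hPI, hPc, hPcov⟩ := hP t ht htB
      refine half_uncovered_le hw hPcov ?_
      have h1 := hstep P hPI
      have h2 := mul_le_mul_of_nonneg_right hPc hr0
      simp only [← hG]
      linarith
    -- The price is at least 2B. The rest of the run costs at most 2B while G ≤ 2 · weight{θ ≥ B},
    -- so it pays at most 4B · weight{θ ≥ B} ≤ 4 ∑ w θ.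
    by_cases hfew : 2 * B * (gainR / c i) ≤ G R
    · have h1 := hhalf B hB.le le_rfl (by linarith)
      have h2 : B * ∑ a ∈ A.filter (fun a => B ≤ θ a), w a ≤ ∑ a ∈ A, w a * θ a := by
        rw [Finset.mul_sum, Finset.sum_filter]
        apply Finset.sum_le_sum
        intro a _
        split_ifs with hB'
        · rw [mul_comm]; exact mul_le_mul_of_nonneg_left hB' (hw a)
        · exact mul_nonneg (hw a) (hθ a)
      have h3 : traceSum (fun i R => max 0 (c i * G R - τ * (G R - G (insert i R)))) (i :: L₂) R ≤
          traceSum (fun i R => c i * G R) (i :: L₂) R := by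
        apply traceSum_mono
        intro j S
        have := mul_nonneg hτ (hins j S)
        exact max_le (mul_nonneg (hc j).le (hG0 S)) (by linarith)
      have h4 := traceSum_mul_le hc hGa (i :: L₂) R
      have h5 := h.sum_le hB.le hI
      rw [hL, List.map_append, List.sum_append] at h5
      have h6 : 0 ≤ (L₁.map c).sum := List.sum_nonneg (by
        intro x hx; obtain ⟨j, -, rfl⟩ := List.mem_map.1 hx; exact (hc j).le)
      have h7 := mul_le_mul_of_nonneg_right (by linarith : ((i :: L₂).map c).sum ≤ 2 * B) (hG0 R)
      have h8 := mul_le_mul_of_nonneg_left h1 hB.le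
      linarith [hpos τ]
    · push Not at hfew
      have hgpos : 0 < gainR := by
        rcases hg0.eq_or_lt with h0 | h0
        · rw [← h0] at hfew
          simp at hfew
          linarith [hG0 R]
        · exact h0
      set p := c i * G R / gainR with hp
      have hp0 : 0 ≤ p := div_nonneg (mul_nonneg hci.le (hG0 R)) hg0
      have hpg : p * gainR = c i * G R := by rw [hp]; field_simp
      have hpB : p ≤ 2 * B := by
        rw [hp, div_le_iff₀ hgpos]
        have := mul_lt_mul_of_pos_left hfew hci
        have e : c i * (2 * B * (gainR / c i)) = 2 * B * gainR := by field_simp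
        linarith
      have hset : (L₁ ++ [i]).toFinset = insert i R := by ext y; simp [hR]
      have ih' := ih (L₁ ++ [i]) (by simpa using hL)
      rw [hset] at ih'
      simp only [traceSum]
      rw [← hgain, ← hpg]
      by_cases hpτ : p ≤ τ
      · have : max 0 (p * gainR - τ * gainR) = 0 := by
          apply max_eq_left
          have := mul_le_mul_of_nonneg_right hpτ hg0
          linarith
        rw [this, zero_add]
        exact ih' τ hτ
      · push Not at hpτ
        have h1 : max 0 (p * gainR - τ * gainR) = (p - τ) * gainR := by
          rw [← sub_mul]
          exact max_eq_right (mul_nonneg (by linarith) hg0)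
        -- From here on each unit of covered weight pays at most p - τ more than its excess over p.
        -- The current step and the later ones cover at most G(R) in all, so the extra charge is at
        -- most (p - τ) G(R).
        have h2 : traceSum (fun i R => max 0 (c i * G R - τ * (G R - G (insert i R)))) L₂
            (insert i R) ≤ traceSum (fun i R => max 0 (c i * G R - p * (G R - G (insert i R))) +
              (p - τ) * (G R - G (insert i R))) L₂ (insert i R) := by
          apply traceSum_mono
          intro j S
          have hnn := mul_nonneg (sub_nonneg.2 hpτ.le) (hins j S)
          apply max_le
          · exact add_nonneg (le_max_left _ _) hnn
          · have := le_max_right 0 (c j * G S - p * (G S - G (insert j S)))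
            linarith
        rw [traceSum_add_mul, traceSum_telescope] at h2
        have h3 := ih' p hp0
        have h4 := hhalf (p / 2) (by linarith) (by linarith) (by
          have : p / 2 * (gainR / c i) = p * gainR / c i / 2 := by ring
          rw [this, hpg]
          have : c i * G R / c i = G R := by field_simp
          rw [this])
        have h5 := mul_nonneg (sub_nonneg.2 hpτ.le) (hG0 (insert i R ∪ L₂.toFinset))
        -- Where θ ≥ p/2 this is the identity 2(p - τ) + 4(θ - p/2) = 4(θ - τ/2); elsewhere the left
        -- side vanishes.
        have h6 : 2 * (p - τ) * ∑ a ∈ A.filter (fun a => p / 2 ≤ θ a), w a +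
            4 * ∑ a ∈ A, w a * max 0 (θ a - p / 2) ≤
            4 * ∑ a ∈ A, w a * max 0 (θ a - τ / 2) := by
          rw [Finset.mul_sum, Finset.mul_sum, Finset.mul_sum, Finset.sum_filter,
            ← Finset.sum_add_distrib]
          apply Finset.sum_le_sum
          intro a _
          have hwa := hw a
          split_ifs with hpa
          · rw [max_eq_right (by linarith), max_eq_right (by linarith)]
            apply le_of_eq; ring
          · rw [max_eq_left (by linarith)]
            have := mul_nonneg hwa (le_max_left 0 (θ a - τ / 2))
            linarith
        have h7 := mul_le_mul_of_nonneg_left h4 (sub_nonneg.2 hpτ.le)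
        have h8 : (p - τ) * gainR = (p - τ) * G R - (p - τ) * G (insert i R) := by
          rw [hgain]; ring
        rw [h1]
        nlinarith

/-- The greedy order is within a constant factor of any other order, up to time `B`. -/
theorem greedy_minSum {c : Fin n → ℝ} {I : Finset (Fin n)} {L : List (Fin n)} {B x : ℝ}
    {θ : α → ℝ} (hw : ∀ a, 0 ≤ w a) (hθ : ∀ a, 0 ≤ θ a) (hB : 0 < B) (hc : ∀ i, 0 < c i)
    (hI : ∀ i ∈ I, c i ≤ B)
    (h : IsGreedyTrace (fun R => x - uncovered A w cov R) c (fun s => B ≤ s) I L)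
    (hP : ∀ t, 0 ≤ t → t ≤ B → ∃ P ⊆ I, ∑ j ∈ P, c j ≤ t ∧
      ∀ a ∈ A, θ a < t → ∃ i ∈ P, cov i a) :
    traceSum (fun i R => c i * uncovered A w cov R) L ∅ ≤ 8 * ∑ a ∈ A, w a * θ a := by
  have h1 := greedy_minSum_aux hw hθ hB hc hI h hP [] L rfl 0 le_rfl
  have h2 : traceSum (fun i R => c i * uncovered A w cov R) L ∅ ≤
      traceSum (fun i R => max 0 (c i * uncovered A w cov R -
        0 * (uncovered A w cov R - uncovered A w cov (insert i R)))) L ∅ :=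
    traceSum_mono (fun i R => by simp) L ∅
  have h3 : ∑ a ∈ A, w a * max 0 (θ a - 0 / 2) = ∑ a ∈ A, w a * θ a :=
    Finset.sum_congr rfl fun a _ => by simp [hθ a]
  rw [h3] at h1
  simp only [List.toFinset_nil] at h1
  linarith

/-- The weight left uncovered by a greedy run that spends `B` or runs out of candidates. -/
theorem greedy_uncovered_le {c : Fin n → ℝ} {I : Finset (Fin n)} {L : List (Fin n)} {B x : ℝ}
    {θ : α → ℝ} (hw : ∀ a, 0 ≤ w a) (hθ : ∀ a, 0 ≤ θ a) (hB : 0 < B) (hc : ∀ i, 0 < c i)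
    (hI : ∀ i ∈ I, c i ≤ B)
    (h : IsGreedyTrace (fun R => x - uncovered A w cov R) c (fun s => B ≤ s) I L)
    (hP : ∀ t, 0 ≤ t → t ≤ B → ∃ P ⊆ I, ∑ j ∈ P, c j ≤ t ∧
      ∀ a ∈ A, θ a < t → ∃ i ∈ P, cov i a) :
    B * uncovered A w cov L.toFinset ≤ 8 * ∑ a ∈ A, w a * θ a := by
  classical
  rcases h.2 with hall | hhalt
  · obtain ⟨P, hPI, -, hcov⟩ := hP B hB.le le_rfl
    -- All candidates were used, so whatever is still uncovered escapes every alternative set and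
    -- has θ ≥ B.
    have h1 : B * uncovered A w cov L.toFinset ≤ ∑ a ∈ A, w a * θ a := by
      unfold uncovered
      rw [Finset.mul_sum, Finset.sum_filter]
      apply Finset.sum_le_sum
      intro a ha
      split_ifs with h2
      · rw [mul_comm]
        refine mul_le_mul_of_nonneg_left ?_ (hw a)
        by_contra hlt
        obtain ⟨i, hi, hci⟩ := hcov a ha (not_le.1 hlt)
        exact h2 i (List.mem_toFinset.2 (hall i (hPI hi))) hci
      · exact mul_nonneg (hw a) (hθ a)
    have h2 : 0 ≤ ∑ a ∈ A, w a * θ a := Finset.sum_nonneg fun a _ => mul_nonneg (hw a) (hθ a)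
    linarith
  · have h1 := le_traceSum_mul hc (uncovered_antitone (A := A) (cov := cov) hw) L ∅
    rw [Finset.empty_union] at h1
    have h2 := mul_le_mul_of_nonneg_right hhalt (uncovered_nonneg (A := A) (cov := cov) hw L.toFinset)
    exact (h2.trans h1).trans (greedy_minSum hw hθ hB hc hI h hP)

end Uncovered

/-! ## Realizations consistent with a partial realization -/

theorem extends_fullReal_setState {n : ℕ} {b : PartialReal n Bool} {i : Fin n} {γ : Bool}
    {a : Fin n → Bool} (hi : b i = none) :
    Extends (fullReal a) (setState b i γ) ↔ Extends (fullReal a) b ∧ a i = γ := by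
  constructor
  · intro h
    refine ⟨h.trans (extends_setState hi γ), ?_⟩
    have := h i (by simp [setState])
    simpa [fullReal, setState] using this
  · rintro ⟨h, rfl⟩ j hj
    by_cases hji : j = i
    · subst hji; simp [setState, fullReal]
    · simp only [setState, Function.update_of_ne hji] at hj ⊢
      exact h j hj

theorem extends_fullReal_setStates {n : ℕ} {b : PartialReal n Bool} {σ : Fin n → Bool}
    {R : Finset (Fin n)} {a : Fin n → Bool} (hR : R ⊆ undet b) :
    Extends (fullReal a) (setStates b σ R) ↔ Extends (fullReal a) b ∧ ∀ i ∈ R, ¬ a i ≠ σ i := by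
  constructor
  · intro h
    have h' := extends_setStates (σ := σ) (Finset.empty_subset R) hR
    rw [setStates_empty] at h'
    refine ⟨h.trans h', fun i hi => ?_⟩
    have := h i (by simp [setStates, hi])
    simpa [fullReal, setStates, hi] using this
  · rintro ⟨h, h'⟩ j hj
    by_cases hjR : j ∈ R
    · have := h' j hjR
      simp only [not_not] at this
      simp [setStates, hjR, fullReal, this]
    · simp only [setStates, hjR, if_false] at hj ⊢
      exact h j hj

open Classical in
/-- The realizations of the sample that extend `b`. -/
def consistent {n : ℕ} (S : Finset (Fin n → Bool)) (b : PartialReal n Bool) :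
    Finset (Fin n → Bool) :=
  S.filter fun a => Extends (fullReal a) b

theorem sum_consistent_split {n : ℕ} (S : Finset (Fin n → Bool)) {b : PartialReal n Bool}
    {i : Fin n} (hi : b i = none) (γ : Bool) (f : (Fin n → Bool) → ℝ) :
    ∑ a ∈ consistent S b, f a = ∑ a ∈ consistent S (setState b i γ), f a +
      ∑ a ∈ consistent S (setState b i (!γ)), f a := by
  classical
  unfold consistent
  simp only [extends_fullReal_setState hi, Finset.sum_filter, ← Finset.sum_add_distrib]
  apply Finset.sum_congr rfl
  intro a _
  by_cases h : Extends (fullReal a) b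
  · cases γ <;> cases h' : a i <;> simp [h]
  · simp [h]

/-- Weighted cost of a tree used on the consistent realizations. -/
def weightedCost {n : ℕ} {β : Type} (S : Finset (Fin n → Bool)) (w : (Fin n → Bool) → ℕ)
    (c : Fin n → ℝ) (T : DTree n Bool β) (b : PartialReal n Bool) : ℝ :=
  ∑ a ∈ consistent S b, (w a : ℝ) * T.cost c a

/-- Cost of the undetermined items that `T` queries on `a`. -/
def restCost {n : ℕ} {β : Type} (c : Fin n → ℝ) (T : DTree n Bool β) (b : PartialReal n Bool)
    (a : Fin n → Bool) : ℝ :=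
  ∑ i ∈ T.queried a ∩ undet b, c i

/-- Weighted cost of the undetermined items that a tree queries on consistent realizations. -/
def weightedRestCost {n : ℕ} {β : Type} (S : Finset (Fin n → Bool)) (w : (Fin n → Bool) → ℕ)
    (c : Fin n → ℝ) (T : DTree n Bool β) (b : PartialReal n Bool) : ℝ :=
  ∑ a ∈ consistent S b, (w a : ℝ) * restCost c T b a

section Cost

variable {n : ℕ} {S : Finset (Fin n → Bool)} {w : (Fin n → Bool) → ℕ} {c : Fin n → ℝ}

theorem restCost_nonneg {β : Type} (hc : ∀ i, 0 < c i) (T : DTree n Bool β)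
    (b : PartialReal n Bool) (a : Fin n → Bool) : 0 ≤ restCost c T b a :=
  Finset.sum_nonneg fun i _ => (hc i).le

theorem weightedRestCost_nonneg {β : Type} (hc : ∀ i, 0 < c i) (T : DTree n Bool β)
    (b : PartialReal n Bool) : 0 ≤ weightedRestCost S w c T b :=
  Finset.sum_nonneg fun a _ => mul_nonneg (Nat.cast_nonneg _) (restCost_nonneg hc T b a)

/-- The two children partition the consistent realizations and have fewer undetermined items. This
lets the bounds for all recursive calls of one backbone be added without loss. -/
theorem weightedRestCost_split {β : Type} (hc : ∀ i, 0 < c i) (T : DTree n Bool β)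
    {b : PartialReal n Bool} {i : Fin n} (hi : b i = none) (γ : Bool) :
    weightedRestCost S w c T (setState b i γ) + weightedRestCost S w c T (setState b i (!γ)) ≤
      weightedRestCost S w c T b := by
  have h : ∀ γ a, restCost c T (setState b i γ) a ≤ restCost c T b a := by
    intro γ a
    refine Finset.sum_le_sum_of_subset_of_nonneg ?_ fun j _ _ => (hc j).le
    apply Finset.inter_subset_inter_left
    intro j hj
    rw [mem_undet] at hj ⊢
    by_contra hne
    rw [extends_setState hi γ j hne] at hj
    exact hne hj
  unfold weightedRestCost
  rw [sum_consistent_split S hi γ]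
  exact add_le_add
    (Finset.sum_le_sum fun a _ => mul_le_mul_of_nonneg_left (h _ a) (Nat.cast_nonneg _))
    (Finset.sum_le_sum fun a _ => mul_le_mul_of_nonneg_left (h _ a) (Nat.cast_nonneg _))

theorem DTree.cost_node_le {β : Type} (hc : ∀ i, 0 < c i) (i : Fin n)
    (child : Bool → DTree n Bool β) (a : Fin n → Bool) :
    (DTree.node i child).cost c a ≤ c i + (child (a i)).cost c a := by
  unfold DTree.cost
  simp only [DTree.queried]
  by_cases h : i ∈ (child (a i)).queried a
  · rw [Finset.insert_eq_of_mem h]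
    linarith [hc i]
  · rw [Finset.sum_insert h]

theorem weightedCost_node_le {β : Type} (hc : ∀ i, 0 < c i) {i : Fin n}
    (child : Bool → DTree n Bool β) {b : PartialReal n Bool} (hi : b i = none) (γ : Bool) :
    weightedCost S w c (.node i child) b ≤ c i * ∑ a ∈ consistent S b, (w a : ℝ) +
      weightedCost S w c (child γ) (setState b i γ) +
      weightedCost S w c (child !γ) (setState b i !γ) := by
  unfold weightedCost
  have key : ∀ γ, ∑ a ∈ consistent S (setState b i γ), (w a : ℝ) * (DTree.node i child).cost c a ≤
      c i * ∑ a ∈ consistent S (setState b i γ), (w a : ℝ) +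
      ∑ a ∈ consistent S (setState b i γ), (w a : ℝ) * (child γ).cost c a := by
    intro γ
    rw [Finset.mul_sum, ← Finset.sum_add_distrib]
    apply Finset.sum_le_sum
    intro a ha
    have hai : a i = γ := by
      classical
      unfold consistent at ha
      rw [Finset.mem_filter, extends_fullReal_setState hi] at ha
      exact ha.2.2
    have h1 := DTree.cost_node_le hc i child a
    rw [hai] at h1
    have := mul_le_mul_of_nonneg_left h1 (Nat.cast_nonneg (w a) : (0 : ℝ) ≤ w a)
    linarith
  rw [sum_consistent_split S hi γ, sum_consistent_split S hi γ (fun a => (w a : ℝ)), mul_add]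
  linarith [key γ, key !γ]

/-- The weight that reaches the node of the backbone at which the items of `R` have been
queried. -/
def survivingWeight (S : Finset (Fin n → Bool)) (w : (Fin n → Bool) → ℕ)
    (b : PartialReal n Bool) (σ : Fin n → Bool) (R : Finset (Fin n)) : ℝ :=
  uncovered (consistent S b) (fun a => (w a : ℝ)) (fun i a => a i ≠ σ i) R

theorem survivingWeight_eq {b : PartialReal n Bool} {σ : Fin n → Bool} {R : Finset (Fin n)}
    (hR : R ⊆ undet b) :
    survivingWeight S w b σ R = ∑ a ∈ consistent S (setStates b σ R), (w a : ℝ) := by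
  classical
  unfold survivingWeight uncovered consistent
  apply Finset.sum_congr _ fun _ _ => rfl
  ext a
  simp only [Finset.mem_filter, extends_fullReal_setStates hR, and_assoc]

theorem removedWeight_eq (b : PartialReal n Bool) (σ : Fin n → Bool) :
    removedWeight S w b σ = fun R => ∑ a ∈ consistent S b, (w a : ℝ) -
      uncovered (consistent S b) (fun a => (w a : ℝ)) (fun i a => a i ≠ σ i) R := by
  classical
  funext R
  rw [eq_sub_iff_add_eq]
  unfold removedWeight uncovered consistent
  simp only [Finset.sum_filter, ← Finset.sum_add_distrib]
  apply Finset.sum_congr rfl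
  intro a _
  by_cases h : Extends (fullReal a) b
  · by_cases h' : ∃ i ∈ R, a i ≠ σ i
    · have : ¬ ∀ i ∈ R, ¬ a i ≠ σ i := by push Not; exact h'
      simp only [h, h', this, and_self, if_true, if_false, add_zero]
    · have : ∀ i ∈ R, ¬ a i ≠ σ i := by push Not at h' ⊢; exact h'
      simp only [h, h', and_false, if_false, zero_add]
      rw [if_pos this, if_true]
  · simp [h]

/-- Each backbone node is charged its cost times the weight that reaches it; every subtree hanging
off the backbone is charged to the cost of `T` on its own realizations. -/
theorem weightedCost_attachBackbone_le {β : Type} (hc : ∀ i, 0 < c i)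
    (call : PartialReal n Bool → DTree n Bool Unit) (T : DTree n Bool β)
    (σ : Fin n → Bool) (b : PartialReal n Bool) {K : ℝ} (hK : 0 ≤ K)
    (hoff : ∀ b' i, b i = none → Extends b' (setState b i (!σ i)) →
      weightedCost S w c (call b') b' ≤ K * weightedRestCost S w c T b')
    (L : List (Fin n)) (R : Finset (Fin n)) (hR : R ⊆ undet b) (hnd : L.Nodup)
    (hL : ∀ i ∈ L, i ∈ undet b ∧ i ∉ R)
    (hend : weightedCost S w c (call (setStates b σ (R ∪ L.toFinset)))
      (setStates b σ (R ∪ L.toFinset)) ≤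
        K * weightedRestCost S w c T (setStates b σ (R ∪ L.toFinset))) :
    weightedCost S w c (attachBackbone call σ L (setStates b σ R)) (setStates b σ R) ≤
      traceSum (fun i R => c i * survivingWeight S w b σ R) L R +
        K * weightedRestCost S w c T (setStates b σ R) := by
  induction L generalizing R with
  | nil =>
    simp only [List.toFinset_nil, Finset.union_empty] at hend
    simpa [attachBackbone, traceSum] using hend
  | cons i L ih =>
    have hi := hL i (by simp)
    have hbi := mem_undet.1 hi.1
    have hRi : setStates b σ R i = none := by simp [setStates, hi.2, hbi]
    have hset : insert i R ∪ L.toFinset = R ∪ (i :: L).toFinset := by ext x; simp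
    rw [List.nodup_cons] at hnd
    have h1 := ih (insert i R) (Finset.insert_subset hi.1 hR) hnd.2
      (fun j hj => ⟨(hL j (by simp [hj])).1, by
        have := (hL j (by simp [hj])).2
        simp only [Finset.mem_insert, this, or_false]
        rintro rfl; exact hnd.1 hj⟩) (by rw [hset]; exact hend)
    rw [setStates_insert] at h1
    simp only [attachBackbone]
    have hext : Extends (setState (setStates b σ R) i (!σ i)) (setState b i (!σ i)) := by
      intro j hj
      by_cases hji : j = i
      · subst hji; simp [setState]
      · simp only [setState, Function.update_of_ne hji] at hj ⊢
        have := extends_setStates (σ := σ) (Finset.empty_subset R) hR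
        rw [setStates_empty] at this
        exact this j hj
    have h3 := hoff _ i hbi hext
    have h4 := mul_le_mul_of_nonneg_left
      (weightedRestCost_split (S := S) (w := w) hc T hRi (σ i)) hK
    refine (weightedCost_node_le hc _ hRi (σ i)).trans ?_
    rw [← survivingWeight_eq hR]
    simp only [traceSum, if_true, Bool.not_eq_eq_eq_not, Bool.eq_not_self, if_false]
    linarith

/-! ## Properties of a tree that computes the function -/

/-- Follow the path of `T` on `x` and stop just before the undetermined items met would cost more
than `t`. A realization that agrees with `x` on this prefix follows the same path and pays at least
`t`. Here `D` is the part of the prefix collected so far; being a set, it counts repeated queries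
once. -/
theorem exists_prefix {β : Type} (hc : ∀ i, 0 < c i) (b : PartialReal n Bool)
    (x : Fin n → Bool) (hx : Extends (fullReal x) b) {t : ℝ} (T : DTree n Bool β)
    (D : Finset (Fin n)) (hD : D ⊆ undet b) (hDt : ∑ i ∈ D, c i ≤ t)
    (ht : t ≤ ∑ i ∈ D ∪ (T.queried x ∩ undet b), c i) :
    ∃ P, D ⊆ P ∧ P ⊆ undet b ∧ ∑ i ∈ P, c i ≤ t ∧
      ∀ a, Extends (fullReal a) b → ∑ i ∈ D ∪ (T.queried a ∩ undet b), c i < t →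
        ∃ i ∈ P, a i ≠ x i := by
  induction T generalizing D with
  | leaf out =>
    refine ⟨D, le_rfl, hD, hDt, fun a _ h => ?_⟩
    simp only [DTree.queried, Finset.empty_inter, Finset.union_empty] at h ht
    linarith
  | node i child ih =>
    simp only [DTree.queried] at ht ⊢
    by_cases hi : i ∈ undet b
    · have hins : ∀ U : Finset (Fin n), D ∪ (insert i U ∩ undet b) =
          insert i D ∪ (U ∩ undet b) := by
        intro U
        rw [Finset.insert_inter_of_mem hi]
        simp
      simp only [hins] at ht ⊢
      by_cases hcost : ∑ j ∈ insert i D, c j ≤ t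
      · obtain ⟨P, h1, h2, h3, h4⟩ := ih (x i) (insert i D) (Finset.insert_subset hi hD) hcost ht
        refine ⟨P, (Finset.subset_insert i D).trans h1, h2, h3, fun a ha hlt => ?_⟩
        by_cases hai : a i = x i
        · rw [hai] at hlt
          exact h4 a ha hlt
        · exact ⟨i, h1 (Finset.mem_insert_self _ _), hai⟩
      -- Every realization still on the path pays for `i` as well, hence more than `t`.
      · refine ⟨D, le_rfl, hD, hDt, fun a _ hlt => absurd hlt (not_lt.2 ?_)⟩
        exact (not_le.1 hcost).le.trans (Finset.sum_le_sum_of_subset_of_nonneg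
          Finset.subset_union_left fun j _ _ => (hc j).le)
    -- A determined item is free, and all consistent realizations agree with `x` on it.
    · simp only [Finset.insert_inter_of_notMem hi] at ht ⊢
      obtain ⟨P, h1, h2, h3, h4⟩ := ih (x i) D hD hDt ht
      refine ⟨P, h1, h2, h3, fun a ha hlt => ?_⟩
      have hne : b i ≠ none := fun h => hi (mem_undet.2 h)
      have hai : a i = x i := by
        have := (ha i hne).trans (hx i hne).symm
        simpa [fullReal] using this
      rw [hai] at hlt
      exact h4 a ha hlt

theorem DTree.output_eq_of_agree {β : Type} (T : DTree n Bool β) (a a' : Fin n → Bool)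
    (h : ∀ i ∈ T.queried a, a' i = a i) : T.output a' = T.output a := by
  induction T with
  | leaf out => rfl
  | node i child ih =>
    simp only [DTree.queried, Finset.mem_insert, forall_eq_or_imp] at h
    simp only [DTree.output, h.1]
    exact ih _ h.2

/-- The path followed by a tree that computes the function certifies its value. -/
theorem kOfNGap_pathReal {k : ℕ} (hkn : k ≤ n) {T : DTree n Bool Bool}
    (hT : Computes T (kOfN n k)) (a : Fin n → Bool) : kOfNGap n k (T.pathReal a) = 0 := by
  rw [kOfNGap_eq_zero]
  by_contra hcon
  push Not at hcon
  -- Fill the unread bits with all ones or all zeros: `T` answers the same. If neither threshold had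
  -- been met, the first completion would have at least k ones and the second fewer than k.
  have hcomp : ∀ γ : Bool, kOfN n k (fun i => if i ∈ T.queried a then a i else γ) =
      kOfN n k a := by
    intro γ
    rw [← hT, ← hT]
    exact DTree.output_eq_of_agree T _ _ fun i hi => by simp [hi]
  have h1 := (hcomp true).trans (hcomp false).symm
  have hfull := countState_fullReal fun i => if i ∈ T.queried a then a i else true
  have ht : countState false (fullReal fun i => if i ∈ T.queried a then a i else true) =
      countState false (T.pathReal a) := by
    unfold countState
    congr 1; ext i
    by_cases hi : i ∈ T.queried a <;> simp [fullReal, DTree.pathReal, hi]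
  have hf : countState true (fullReal fun i => if i ∈ T.queried a then a i else false) =
      countState true (T.pathReal a) := by
    unfold countState
    congr 1; ext i
    by_cases hi : i ∈ T.queried a <;> simp [fullReal, DTree.pathReal, hi]
  have hk : ∀ x : Fin n → Bool, kOfN n k x = decide (k ≤ countState true (fullReal x)) := by
    intro x
    simp [kOfN, countState, fullReal]
  rw [hk, hk, hf, decide_eq_decide] at h1
  omega

theorem kOfNGap_setStates_queried {k : ℕ} (hkn : k ≤ n) {T : DTree n Bool Bool}
    (hT : Computes T (kOfN n k)) (b : PartialReal n Bool) (σ : Fin n → Bool) :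
    kOfNGap n k (setStates b σ
      (T.queried (fun i => (b i).getD (σ i)) ∩ undet b)) = 0 := by
  set x : Fin n → Bool := fun i => (b i).getD (σ i)
  have h := kOfNGap_pathReal hkn hT x
  have hext : Extends (setStates b σ (T.queried x ∩ undet b)) (T.pathReal x) := by
    intro i hi
    have hq : i ∈ T.queried x := by
      by_contra hq
      simp [DTree.pathReal, hq] at hi
    have hxi : x i = (b i).getD (σ i) := rfl
    cases hb : b i <;> simp [setStates, DTree.pathReal, hq, mem_undet, hb, hxi]
  have := kOfNGap_antitone (k := k) hext
  omega

end Cost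

/-! ## The backbone built by one call -/

/-- What the analysis uses about the backbone: its two stages are greedy runs, and the budget `B`
lies between the cost of a set of large utility and that of any set that reaches the goal. -/
structure BackboneSpec {n : ℕ} (k : ℕ) (S : Finset (Fin n → Bool)) (w : (Fin n → Bool) → ℕ)
    (c : Fin n → ℝ) (b : PartialReal n Bool) (σ : Fin n → Bool) (B : ℝ) (Y₁ Y₂ : List (Fin n)) :
    Prop where
  pos : 0 < B
  exists_good : ∃ Z ⊆ undet b, ∑ j ∈ Z, c j ≤ B ∧ wolseyAlpha * kOfNGap n k b ≤
    (kOfNUtility n k (setStates b σ Z) : ℝ) - kOfNUtility n k b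
  le_cost : ∀ P ⊆ undet b, kOfNGap n k (setStates b σ P) = 0 → B ≤ ∑ j ∈ P, c j
  first : IsGreedyTrace (removedWeight S w b σ) c (fun s => B ≤ s)
    ((undet b).filter fun i => c i ≤ B) Y₁
  second : IsGreedyTrace (fun U => (kOfNUtility n k (setStates b σ (Y₁.toFinset ∪ U)) : ℝ)) c
    (fun s => B ≤ s) ((undet b \ Y₁.toFinset).filter fun i => c i ≤ B) Y₂

section Backbone

variable {n k : ℕ} {S : Finset (Fin n → Bool)} {w : (Fin n → Bool) → ℕ} {c : Fin n → ℝ}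
  {b : PartialReal n Bool}

/-- Completing `b` by the worst-case states reaches the goal, so the total value under the set
function is exactly the gap, and any set that reaches the goal has this full value. -/
theorem exists_backboneSpec (hkn : k ≤ n) (tb : TieBreaking n Bool (kOfNUtility n k))
    (hc : ∀ i, 0 < c i) (hb : kOfNGap n k b ≠ 0) :
    ∃ B Y₁ Y₂, backboneItems tb S w c b = Y₁ ++ Y₂ ∧
      BackboneSpec k S w c b (tb.sigma b) B Y₁ Y₂ := by
  set σ := tb.sigma b
  set F : Finset (Fin n) → ℝ := fun U =>
    (kOfNUtility n k (setStates b σ U) : ℝ) - (kOfNUtility n k b : ℝ) with hFdef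
  have hF : MonoSubmodularOn (undet b) F := by
    have := monoSubmodularOn_setStates k b σ (kOfNUtility n k b) (Finset.empty_subset (undet b))
    simpa only [Finset.empty_union] using this
  have hF0 : F ∅ = 0 := by simp [hFdef, setStates_empty]
  have hgoal : ∀ P, kOfNGap n k (setStates b σ P) = 0 → F P = kOfNGap n k b := by
    intro P hP
    simp only [hFdef, kOfNUtility_cast, hP]
    push_cast
    ring
  have hN : F (undet b) = kOfNGap n k b := by
    apply hgoal
    rw [setStates_undet, ← kOfNUtility_eq_goal_iff_gap]
    exact kOfNUtility_hasGoalValue hkn _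
  have hgap : (0 : ℝ) < kOfNGap n k b := by exact_mod_cast Nat.pos_of_ne_zero hb
  have hgood := exists_subset_findBudget (tb.wolsey_spec b) hF hF0 hc
  refine ⟨findBudget (tb.wolsey b) (undet b) F c, _, _, rfl, ?_, ?_, ?_, ?_, ?_⟩
  · obtain ⟨Z, hZN, hZc, hZ⟩ := hgood
    -- The budget is positive because the empty set is worth nothing while α times the gap is
    -- positive.
    have hne : Z.Nonempty := by
      rw [Finset.nonempty_iff_ne_empty]
      rintro rfl
      rw [hF0, hN] at hZ
      have := mul_pos wolseyAlpha_pos hgap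
      linarith
    exact (Finset.sum_pos (fun i _ => hc i) hne).trans_le hZc
  · rwa [hN] at hgood
  · intro P hP hP0
    exact findBudget_le (tb.wolsey_spec b) hF hF0 hc hP ((hgoal P hP0).trans hN.symm)
  · exact greedyRun_isGreedyTrace (tb.stage₁_spec b) _ _ _ _ _
  · exact greedyRun_isGreedyTrace (tb.stage₂_spec b) _ _ _ _ _

variable {σ : Fin n → Bool} {B : ℝ} {Y₁ Y₂ : List (Fin n)}

theorem BackboneSpec.mem_undet (h : BackboneSpec k S w c b σ B Y₁ Y₂) {i : Fin n}
    (hi : i ∈ Y₁ ++ Y₂) : i ∈ undet b := by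
  rcases List.mem_append.1 hi with hi | hi
  · exact (Finset.mem_filter.1 (h.first.mem hi)).1
  · exact (Finset.mem_sdiff.1 (Finset.mem_filter.1 (h.second.mem hi)).1).1

theorem BackboneSpec.nodup (h : BackboneSpec k S w c b σ B Y₁ Y₂) : (Y₁ ++ Y₂).Nodup := by
  rw [List.nodup_append]
  refine ⟨h.first.nodup, h.second.nodup, ?_⟩
  rintro i hi j hj rfl
  exact (Finset.mem_sdiff.1 (Finset.mem_filter.1 (h.second.mem hj)).1).2
    (List.mem_toFinset.2 hi)

/-- Guarantees that each recursive call has fewer undetermined items than its caller. -/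
theorem BackboneSpec.ne_nil (h : BackboneSpec k S w c b σ B Y₁ Y₂) (hb : kOfNGap n k b ≠ 0)
    (hc : ∀ i, 0 < c i) : Y₁ ++ Y₂ ≠ [] := by
  intro hnil
  obtain ⟨rfl, rfl⟩ := List.append_eq_nil_iff.1 hnil
  obtain ⟨Z, hZN, hZc, hZ⟩ := h.exists_good
  rcases h.first.2 with hall | hhalt
  · have hZe : Z = ∅ := by
      rw [Finset.eq_empty_iff_forall_notMem]
      intro i hi
      have := hall i (Finset.mem_filter.2
        ⟨hZN hi, (Finset.single_le_sum (fun j _ => (hc j).le) hi).trans hZc⟩)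
      simp at this
    have hgap : (0 : ℝ) < kOfNGap n k b := by exact_mod_cast Nat.pos_of_ne_zero hb
    have := mul_pos wolseyAlpha_pos hgap
    rw [hZe, setStates_empty] at hZ
    linarith
  · have := h.pos
    simp at hhalt
    linarith

/-- The second stage closes a constant fraction of the gap. -/
theorem BackboneSpec.gap_end_le (h : BackboneSpec k S w c b σ B Y₁ Y₂) (hc : ∀ i, 0 < c i) :
    (kOfNGap n k (setStates b σ (Y₁ ++ Y₂).toFinset) : ℝ) ≤
      (1 - wolseyAlpha / 2) * kOfNGap n k b := by
  obtain ⟨Z, hZN, hZc, hZ⟩ := h.exists_good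
  have hY₁ : Y₁.toFinset ⊆ undet b := fun i hi =>
    h.mem_undet (List.mem_append_left _ (List.mem_toFinset.1 hi))
  have hF := monoSubmodularOn_setStates k b σ 0 hY₁
  simp only [sub_zero] at hF
  have hZ' : Z \ Y₁.toFinset ⊆ (undet b \ Y₁.toFinset).filter fun i => c i ≤ B := by
    intro i hi
    have hi' := Finset.mem_sdiff.1 hi
    exact Finset.mem_filter.2 ⟨Finset.sdiff_subset_sdiff hZN le_rfl hi,
      (Finset.single_le_sum (fun j _ => (hc j).le) hi'.1).trans hZc⟩
  have hmono : ∀ R R', R ⊆ R' → R' ⊆ undet b →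
      (kOfNUtility n k (setStates b σ R) : ℝ) ≤ kOfNUtility n k (setStates b σ R') := by
    intro R R' hR hR'
    exact_mod_cast kOfNUtility_mono (extends_setStates hR hR')
  -- Compare with Z minus the first-stage items: together with these it is worth at least as much as
  -- Z, and the second stage starts from at least g(b). Halving yields g(b) + (α/2) gap(b).
  have h1 := h.second.half_le hF
    ((Finset.filter_subset _ _).trans Finset.sdiff_subset) hc h.pos hZ'
    ((Finset.sum_le_sum_of_subset_of_nonneg Finset.sdiff_subset
      fun j _ _ => (hc j).le).trans hZc) le_rfl
  simp only [Finset.union_empty, Finset.union_sdiff_self_eq_union] at h1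
  have h2 := hmono ∅ _ (Finset.empty_subset _) hY₁
  rw [setStates_empty] at h2
  have h3 := hmono Z (Y₁.toFinset ∪ Z) Finset.subset_union_right (Finset.union_subset hY₁ hZN)
  rw [List.toFinset_append]
  have h4 := kOfNUtility_cast n k (setStates b σ (Y₁.toFinset ∪ Y₂.toFinset))
  have h5 := kOfNUtility_cast n k b
  linarith

/-- The cost of the backbone is within a constant factor of the cost of any tree that computes
the function. -/
theorem BackboneSpec.cost_le (hkn : k ≤ n) (h : BackboneSpec k S w c b σ B Y₁ Y₂)
    (hc : ∀ i, 0 < c i) {T : DTree n Bool Bool} (hT : Computes T (kOfN n k)) :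
    traceSum (fun i R => c i * survivingWeight S w b σ R) (Y₁ ++ Y₂) ∅ ≤
      24 * weightedRestCost S w c T b := by
  have hw : ∀ a : Fin n → Bool, (0 : ℝ) ≤ w a := fun a => Nat.cast_nonneg _
  have hθ := restCost_nonneg hc T b
  have hI : ∀ i ∈ (undet b).filter (fun i => c i ≤ B), c i ≤ B := fun i hi =>
    (Finset.mem_filter.1 hi).2
  have hfirst := h.first
  rw [removedWeight_eq] at hfirst
  set x : Fin n → Bool := fun i => (b i).getD (σ i) with hx
  have hxb : Extends (fullReal x) b := by
    intro i hi
    cases hbi : b i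
    · exact absurd hbi hi
    · simp [fullReal, hx, hbi]
  -- The path of `T` on `x` reaches the goal under σ, so its undetermined items cost at least the
  -- budget.
  have hBx : B ≤ ∑ i ∈ T.queried x ∩ undet b, c i :=
    h.le_cost _ Finset.inter_subset_right (kOfNGap_setStates_queried hkn hT b σ)
  have hP : ∀ t, 0 ≤ t → t ≤ B → ∃ P ⊆ (undet b).filter (fun i => c i ≤ B),
      ∑ j ∈ P, c j ≤ t ∧ ∀ a ∈ consistent S b, restCost c T b a < t →
        ∃ i ∈ P, a i ≠ σ i := by
    intro t ht htB
    obtain ⟨P, -, hPb, hPt, hPcov⟩ := exists_prefix hc b x hxb (t := t) T ∅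
      (Finset.empty_subset _) (by simpa using ht)
      (by rw [Finset.empty_union]; exact htB.trans hBx)
    refine ⟨P, fun i hi => Finset.mem_filter.2 ⟨hPb hi,
      (Finset.single_le_sum (fun j _ => (hc j).le) hi).trans (hPt.trans htB)⟩, hPt, ?_⟩
    intro a ha hlt
    have hab : Extends (fullReal a) b := by
      classical
      unfold consistent at ha
      exact (Finset.mem_filter.1 ha).2
    obtain ⟨i, hi, hai⟩ := hPcov a hab (by simpa [restCost] using hlt)
    refine ⟨i, hi, ?_⟩
    have hbi := _root_.mem_undet.1 (hPb hi)
    simpa [hx, hbi] using hai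
  -- The constant is 24 = 8 + 2 · 8: the first stage costs 8 times the cost of `T`, and the second
  -- spends at most 2B on a surviving weight that satisfies B · weight ≤ 8 times that cost.
  have h1 := greedy_minSum hw hθ h.pos hc hI hfirst hP
  have h2 := greedy_uncovered_le hw hθ h.pos hc hI hfirst hP
  have hanti : Antitone (survivingWeight S w b σ) := uncovered_antitone hw
  have h3 := traceSum_mul_le hc hanti Y₂ Y₁.toFinset
  have h4 := h.second.sum_le h.pos.le fun i hi => (Finset.mem_filter.1 hi).2
  have h5 := mul_le_mul_of_nonneg_right h4
    (uncovered_nonneg (A := consistent S b) (cov := fun i a => a i ≠ σ i) hw Y₁.toFinset)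
  rw [traceSum_append, Finset.empty_union]
  unfold weightedRestCost
  unfold survivingWeight at *
  linarith

end Backbone

/-! ## Cost of Mixed Greedy -/

section MixedGreedy

variable {n k : ℕ} {S : Finset (Fin n → Bool)} {w : (Fin n → Bool) → ℕ} {c : Fin n → ℝ}

theorem weightedCost_leaf {β : Type} (out : β) (b : PartialReal n Bool) :
    weightedCost S w c (.leaf out) b = 0 := by
  simp [weightedCost, DTree.cost, DTree.queried]

theorem mixedGreedyRec_of_gap_eq_zero (tb : TieBreaking n Bool (kOfNUtility n k)) (m : ℕ)
    {b : PartialReal n Bool} (hb : kOfNGap n k b = 0) :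
    mixedGreedyRec (kOfNUtility n k) (kOfNGoal n k) tb S w c m b = .leaf () := by
  cases m with
  | zero => rfl
  | succ m => simp [mixedGreedyRec, kOfNUtility_eq_goal_iff_gap.2 hb]

theorem gap_off_backbone_le {wc : PartialReal n Bool → Fin n → Bool} (hk : 1 ≤ k)
    (hwc : IsWorstCase (kOfNUtility n k) wc) {b b' : PartialReal n Bool} {i : Fin n}
    (hi : b i = none) (hb' : Extends b' (setState b i (!wc b i))) :
    (kOfNGap n k b' : ℝ) ≤ (1 - 1 / k) * kOfNGap n k b := by
  have h1 := gap_le_mul_gain hwc hi (γ := !wc b i) (by simp)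
  have h2 : (kOfNGap n k b' : ℝ) ≤ kOfNGap n k (setState b i (!wc b i)) := by
    exact_mod_cast kOfNGap_antitone hb'
  unfold gain at h1
  rw [kOfNUtility_cast, kOfNUtility_cast] at h1
  have hk' : (0 : ℝ) < k := by exact_mod_cast hk
  have h3 : (kOfNGap n k b : ℝ) / k ≤
      kOfNGap n k b - kOfNGap n k (setState b i (!wc b i)) := by
    rw [div_le_iff₀ hk']
    linarith
  have h4 : (1 - 1 / (k : ℝ)) * kOfNGap n k b = kOfNGap n k b - kOfNGap n k b / k := by ring
  linarith

/-- Put δ = α/(2k), a common lower bound of 1/k and α/2. Each recursive call lowers log gap by at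
least δ, so (1/δ) log gap falls by at least 1, and the drop pays for the current backbone. The bound
holds for every `m` because a recursion cut short only costs less. -/
theorem weightedCost_mixedGreedyRec_le (hkn : k ≤ n) (hk : 1 ≤ k)
    (tb : TieBreaking n Bool (kOfNUtility n k)) (hc : ∀ i, 0 < c i)
    {T : DTree n Bool Bool} (hT : Computes T (kOfN n k)) (m : ℕ) (b : PartialReal n Bool) :
    weightedCost S w c (mixedGreedyRec (kOfNUtility n k) (kOfNGoal n k) tb S w c m b) b ≤
      24 * (1 + 2 * k / wolseyAlpha * Real.log (kOfNGap n k b)) *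
        weightedRestCost S w c T b := by
  have hα := wolseyAlpha_pos
  have hα' := wolseyAlpha_le_half
  have hk' : (1 : ℝ) ≤ k := by exact_mod_cast hk
  have hM : 0 < 2 * (k : ℝ) / wolseyAlpha := by positivity
  have hlog : ∀ b : PartialReal n Bool,
      0 ≤ 24 * (2 * k / wolseyAlpha * Real.log (kOfNGap n k b)) := fun b =>
    mul_nonneg (by norm_num) (mul_nonneg hM.le (Real.log_natCast_nonneg _))
  induction m generalizing b with
  | zero =>
    simp only [mixedGreedyRec]
    rw [weightedCost_leaf]
    exact mul_nonneg (by linarith [hlog b]) (weightedRestCost_nonneg hc T b)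
  | succ m ih =>
    by_cases hb : kOfNGap n k b = 0
    · rw [mixedGreedyRec_of_gap_eq_zero tb _ hb, weightedCost_leaf]
      exact mul_nonneg (by linarith [hlog b]) (weightedRestCost_nonneg hc T b)
    obtain ⟨B, Y₁, Y₂, hY, hspec⟩ := exists_backboneSpec (S := S) (w := w) hkn tb hc hb
    have hgap : (0 : ℝ) < kOfNGap n k b := by exact_mod_cast Nat.pos_of_ne_zero hb
    set K := 24 * (2 * k / wolseyAlpha * Real.log (kOfNGap n k b)) with hKdef
    have hrec : ∀ b', (kOfNGap n k b' : ℝ) ≤ (1 - wolseyAlpha / (2 * k)) * kOfNGap n k b →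
        weightedCost S w c (mixedGreedyRec (kOfNUtility n k) (kOfNGoal n k) tb S w c m b') b' ≤
          K * weightedRestCost S w c T b' := by
      intro b' hb'
      -- A call that has reached the goal is a leaf; the decrease of the logarithm makes sense only
      -- for a positive gap, as `Real.log 0 = 0`.
      by_cases h0 : kOfNGap n k b' = 0
      · rw [mixedGreedyRec_of_gap_eq_zero tb _ h0, weightedCost_leaf]
        exact mul_nonneg (hlog b) (weightedRestCost_nonneg hc T b')
      · refine (ih b').trans (mul_le_mul_of_nonneg_right ?_ (weightedRestCost_nonneg hc T b'))
        have hgap' : (0 : ℝ) < kOfNGap n k b' := by exact_mod_cast Nat.pos_of_ne_zero h0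
        have hδ : 0 < 1 - wolseyAlpha / (2 * k) := by
          by_contra hneg
          have := mul_nonneg (sub_nonneg.2 (not_lt.1 hneg)) hgap.le
          linarith
        have h1 := Real.log_le_log hgap' hb'
        rw [Real.log_mul hδ.ne' hgap.ne'] at h1
        have h2 := Real.log_le_sub_one_of_pos hδ
        have h3 : Real.log (kOfNGap n k b') ≤ Real.log (kOfNGap n k b) - wolseyAlpha / (2 * k) := by
          linarith
        have h4 := mul_le_mul_of_nonneg_left h3 hM.le
        have h5 : 2 * (k : ℝ) / wolseyAlpha * (wolseyAlpha / (2 * k)) = 1 := by field_simp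
        rw [mul_sub, h5] at h4
        linarith
    have hfac : ∀ δ : ℝ, wolseyAlpha / (2 * k) ≤ δ →
        (1 - δ) * (kOfNGap n k b : ℝ) ≤ (1 - wolseyAlpha / (2 * k)) * kOfNGap n k b :=
      fun δ hδ => mul_le_mul_of_nonneg_right (by linarith) hgap.le
    have hoff : ∀ b' i, b i = none → Extends b' (setState b i (!tb.sigma b i)) →
        weightedCost S w c (mixedGreedyRec (kOfNUtility n k) (kOfNGoal n k) tb S w c m b') b' ≤
          K * weightedRestCost S w c T b' := by
      intro b' i hi hext
      refine hrec b' ((gap_off_backbone_le hk tb.sigma_spec hi hext).trans (hfac _ ?_))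
      rw [div_le_div_iff₀ (by positivity) (by positivity)]
      nlinarith
    have hend := hrec (setStates b (tb.sigma b) (∅ ∪ (Y₁ ++ Y₂).toFinset)) (by
      rw [Finset.empty_union]
      refine (hspec.gap_end_le hc).trans (hfac _ ?_)
      rw [div_le_div_iff₀ (by positivity) (by positivity)]
      nlinarith)
    have h1 := weightedCost_attachBackbone_le (S := S) (w := w) hc
      (mixedGreedyRec (kOfNUtility n k) (kOfNGoal n k) tb S w c m) T (tb.sigma b) b (hlog b) hoff
      (Y₁ ++ Y₂) ∅ (Finset.empty_subset _) hspec.nodup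
      (fun i hi => ⟨hspec.mem_undet hi, by simp⟩) hend
    rw [setStates_empty] at h1
    have h2 := hspec.cost_le hkn hc hT
    have h3 : kOfNUtility n k b ≠ kOfNGoal n k := fun h => hb (kOfNUtility_eq_goal_iff_gap.1 h)
    simp only [mixedGreedyRec, h3, if_false, hY]
    have h4 : 24 * (1 + 2 * k / wolseyAlpha * Real.log (kOfNGap n k b)) *
        weightedRestCost S w c T b =
        24 * weightedRestCost S w c T b + K * weightedRestCost S w c T b := by
      rw [hKdef]; ring
    rw [h4]
    linarith

/-! ## Correctness of Mixed Greedy -/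

/-- `T`, used from `b` on, repeats no item and reaches the goal. -/
def CoversFrom (k : ℕ) (b : PartialReal n Bool) (T : DTree n Bool Unit) : Prop :=
  T.NoRepeat (undet b)ᶜ ∧ ∀ a : Fin n → Bool, kOfNGap n k (setStates b a (T.queried a)) = 0

theorem undet_setState (b : PartialReal n Bool) (i : Fin n) (γ : Bool) :
    undet (setState b i γ) = (undet b).erase i := by
  ext j
  by_cases hj : j = i
  · subst hj; simp [mem_undet, setState]
  · simp [mem_undet, setState, hj]

theorem coversFrom_leaf {b : PartialReal n Bool} (hb : kOfNGap n k b = 0) :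
    CoversFrom k b (.leaf ()) := by
  refine ⟨trivial, fun a => ?_⟩
  simp only [DTree.queried]
  rwa [setStates_empty]

theorem coversFrom_node {b : PartialReal n Bool} {i : Fin n} (hi : b i = none)
    {child : Bool → DTree n Bool Unit} (h : ∀ γ, CoversFrom k (setState b i γ) (child γ)) :
    CoversFrom k b (.node i child) := by
  refine ⟨⟨by simpa [mem_undet] using hi, fun γ => ?_⟩, fun a => ?_⟩
  · have := (h γ).1
    rw [undet_setState] at this
    have e : insert i (undet b)ᶜ = ((undet b).erase i)ᶜ := by
      ext j; simp only [Finset.mem_insert, Finset.mem_compl, Finset.mem_erase]; tauto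
    rwa [e]
  · simp only [DTree.queried]
    rw [← setStates_setState]
    exact (h (a i)).2 a

/-- One node already removes an undetermined item, so the recursion bound `m` suffices for every
call below the first node; only an empty backbone would need the extra hypothesis `hm`. -/
theorem coversFrom_attachBackbone {call : PartialReal n Bool → DTree n Bool Unit} {m : ℕ}
    (hcall : ∀ b, (undet b).card ≤ m → CoversFrom k b (call b)) (σ : Fin n → Bool)
    (L : List (Fin n)) (b : PartialReal n Bool) (hnd : L.Nodup) (hL : ∀ i ∈ L, i ∈ undet b)
    (hm : L = [] → (undet b).card ≤ m) (hm' : (undet b).card ≤ m + 1) :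
    CoversFrom k b (attachBackbone call σ L b) := by
  induction L generalizing b with
  | nil => exact hcall b (hm rfl)
  | cons i L ih =>
    have hi := hL i (by simp)
    rw [List.nodup_cons] at hnd
    have hcard : ∀ γ, (undet (setState b i γ)).card ≤ m := by
      intro γ
      rw [undet_setState, Finset.card_erase_of_mem hi]
      omega
    simp only [attachBackbone]
    refine coversFrom_node (mem_undet.1 hi) fun γ => ?_
    split_ifs with hγ
    · rw [hγ]
      refine ih _ hnd.2 (fun j hj => ?_) (fun _ => hcard _) ((hcard _).trans (Nat.le_succ m))
      rw [undet_setState, Finset.mem_erase]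
      refine ⟨?_, hL j (by simp [hj])⟩
      rintro rfl
      exact hnd.1 hj
    · exact hcall _ (hcard γ)

theorem coversFrom_mixedGreedyRec (hkn : k ≤ n) (tb : TieBreaking n Bool (kOfNUtility n k))
    (hc : ∀ i, 0 < c i) (m : ℕ) (b : PartialReal n Bool) (hm : (undet b).card ≤ m) :
    CoversFrom k b (mixedGreedyRec (kOfNUtility n k) (kOfNGoal n k) tb S w c m b) := by
  induction m generalizing b with
  | zero =>
    refine coversFrom_leaf ?_
    have h0 : undet b = ∅ := by simpa using hm
    have h1 := setStates_undet b fun _ => true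
    rw [h0, setStates_empty] at h1
    rw [h1, ← kOfNUtility_eq_goal_iff_gap]
    exact kOfNUtility_hasGoalValue hkn _
  | succ m ih =>
    by_cases hb : kOfNGap n k b = 0
    · rw [mixedGreedyRec_of_gap_eq_zero tb _ hb]
      exact coversFrom_leaf hb
    obtain ⟨B, Y₁, Y₂, hY, hspec⟩ := exists_backboneSpec (S := S) (w := w) hkn tb hc hb
    have h3 : kOfNUtility n k b ≠ kOfNGoal n k := fun h => hb (kOfNUtility_eq_goal_iff_gap.1 h)
    simp only [mixedGreedyRec, h3, if_false, hY]
    exact coversFrom_attachBackbone ih _ _ _ hspec.nodup (fun i hi => hspec.mem_undet hi)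
      (fun h => absurd h (hspec.ne_nil hb hc)) hm

theorem coversFrom_mixedGreedy (hkn : k ≤ n) (tb : TieBreaking n Bool (kOfNUtility n k))
    (hc : ∀ i, 0 < c i) :
    CoversFrom k (fun _ => none) (mixedGreedy (kOfNUtility n k) (kOfNGoal n k) tb S w c) :=
  coversFrom_mixedGreedyRec hkn tb hc n _ ((Finset.card_le_univ _).trans (by simp))

/-! ### Labeling the leaves. -/

theorem DTree.queried_relabel {β β' : Type} (φ : PartialReal n Bool → β') (T : DTree n Bool β)
    (b : PartialReal n Bool) (a : Fin n → Bool) : (T.relabel φ b).queried a = T.queried a := by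
  induction T generalizing b with
  | leaf out => rfl
  | node i child ih => simp only [DTree.relabel, DTree.queried, ih]

theorem DTree.output_relabel {β β' : Type} (φ : PartialReal n Bool → β') (T : DTree n Bool β)
    (b : PartialReal n Bool) (a : Fin n → Bool) :
    (T.relabel φ b).output a = φ (setStates b a (T.queried a)) := by
  induction T generalizing b with
  | leaf out => simp only [DTree.relabel, DTree.output, DTree.queried, setStates_empty]
  | node i child ih =>
    simp only [DTree.relabel, DTree.output, DTree.queried, ih, setStates_setState]

theorem isCoverStrategy_mixedGreedy (hkn : k ≤ n) (tb : TieBreaking n Bool (kOfNUtility n k))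
    (hc : ∀ i, 0 < c i) :
    IsCoverStrategy (kOfNUtility n k) (kOfNGoal n k)
      (mixedGreedy (kOfNUtility n k) (kOfNGoal n k) tb S w c) := by
  have h := coversFrom_mixedGreedy (S := S) (w := w) hkn tb hc
  refine ⟨?_, fun a => kOfNUtility_eq_goal_iff_gap.2 (h.2 a)⟩
  have h1 := h.1
  have h2 : (undet fun _ : Fin n => (none : Option Bool))ᶜ = ∅ := by
    ext i; simp [mem_undet]
  rwa [h2] at h1

theorem computes_kOfNTree (hkn : k ≤ n) (tb : TieBreaking n Bool (kOfNUtility n k))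
    (hc : ∀ i, 0 < c i) : Computes (kOfNTree n k tb S w c) (kOfN n k) := by
  intro a
  have h := (coversFrom_mixedGreedy (S := S) (w := w) hkn tb hc).2 a
  unfold kOfNTree
  rw [DTree.output_relabel]
  set b := setStates (fun _ => none) a
    ((mixedGreedy (kOfNUtility n k) (kOfNGoal n k) tb S w c).queried a) with hb
  have hext : Extends (fullReal a) b := by
    rw [hb, extends_fullReal_setStates fun i _ => by simp [mem_undet]]
    exact ⟨fun i hi => absurd rfl hi, by simp⟩
  have h1 := countState_le_of_extends hext true
  have h2 := countState_le_of_extends hext false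
  have h3 := countState_fullReal a
  have h4 : kOfN n k a = decide (k ≤ countState true (fullReal a)) := by
    simp [kOfN, countState, fullReal]
  -- At the goal, either k ones were seen, or n - k + 1 zeros were seen and fewer than k ones exist.
  rw [kOfNGap_eq_zero] at h
  rw [h4, decide_eq_decide]
  omega

/-! ### From weighted sums to expected costs. -/

theorem consistent_none (S : Finset (Fin n → Bool)) : consistent S (fun _ => none) = S := by
  classical
  unfold consistent
  rw [Finset.filter_eq_self]
  exact fun a _ i hi => absurd rfl hi

theorem expectedCost_eq {β : Type} (T : DTree n Bool β) :
    expectedCost S w c T = weightedCost S w c T (fun _ => none) / ∑ a ∈ S, (w a : ℝ) := by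
  unfold expectedCost weightedCost
  rw [consistent_none, Finset.sum_div]
  exact Finset.sum_congr rfl fun a _ => by ring

theorem weightedRestCost_none {β : Type} (T : DTree n Bool β) :
    weightedRestCost S w c T (fun _ => none) = weightedCost S w c T fun _ => none := by
  have h : (undet fun _ : Fin n => (none : Option Bool)) = Finset.univ := by
    ext i; simp [mem_undet]
  simp only [weightedRestCost, weightedCost, restCost, DTree.cost, h, Finset.inter_univ]

theorem weightedCost_kOfNTree (tb : TieBreaking n Bool (kOfNUtility n k))
    (b : PartialReal n Bool) :
    weightedCost S w c (kOfNTree n k tb S w c) b =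
      weightedCost S w c (mixedGreedy (kOfNUtility n k) (kOfNGoal n k) tb S w c) b := by
  simp only [weightedCost, DTree.cost, kOfNTree, DTree.queried_relabel]

theorem expectedCost_kOfNTree_le (hkn : k ≤ n) (hn : 2 ≤ n)
    (tb : TieBreaking n Bool (kOfNUtility n k)) (hc : ∀ i, 0 < c i)
    {T : DTree n Bool Bool} (hT : Computes T (kOfN n k)) :
    expectedCost S w c (kOfNTree n k tb S w c) ≤
      24 * (1 / Real.log 2 + 4 / wolseyAlpha) * (k * Real.log n) * expectedCost S w c T := by
  have hα := wolseyAlpha_pos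
  rw [expectedCost_eq, expectedCost_eq, weightedCost_kOfNTree, ← mul_div_assoc]
  apply div_le_div_of_nonneg_right _ (Finset.sum_nonneg fun a _ => Nat.cast_nonneg _)
  rw [← weightedRestCost_none T]
  rcases Nat.eq_zero_or_pos k with rfl | hk
  -- For k = 0 the root is a leaf, so both sides are zero.
  · have : kOfNGap n 0 (fun _ => none) = 0 := by simp [kOfNGap]
    unfold mixedGreedy
    rw [mixedGreedyRec_of_gap_eq_zero tb _ this, weightedCost_leaf]
    simp
  · have h1 := weightedCost_mixedGreedyRec_le (S := S) (w := w) hkn hk tb hc hT n fun _ => none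
    refine h1.trans (mul_le_mul_of_nonneg_right ?_ (weightedRestCost_nonneg hc T _))
    have hk' : (1 : ℝ) ≤ k := by exact_mod_cast hk
    have hn' : (2 : ℝ) ≤ n := by exact_mod_cast hn
    have hl2 : 0 < Real.log 2 := Real.log_pos (by norm_num)
    have hln : Real.log 2 ≤ Real.log n := Real.log_le_log (by norm_num) hn'
    have h2 : Real.log (kOfNGap n k fun _ => none) ≤ 2 * Real.log n := by
      have hle : kOfNGap n k (fun _ => none) ≤ n ^ 2 := by
        refine (kOfNGap_le n k _).trans ?_
        rw [sq]
        exact Nat.mul_le_mul hkn (by omega)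
      rcases Nat.eq_zero_or_pos (kOfNGap n k fun _ => none) with h0 | h0
      · rw [h0]; simp; linarith
      · have := Real.log_le_log (by exact_mod_cast h0)
          (by exact_mod_cast hle : (kOfNGap n k (fun _ => none) : ℝ) ≤ (n : ℝ) ^ 2)
        rwa [Real.log_pow] at this
    -- Absorbs the additive 1 of the recursion bound; this is where n ≥ 2 is essential.
    have h3 : 1 ≤ 1 / Real.log 2 * (k * Real.log n) := by
      rw [one_div, inv_mul_eq_div, one_le_div hl2]
      nlinarith
    have h4 := mul_le_mul_of_nonneg_left h2
      (by positivity : 0 ≤ 2 * (k : ℝ) / wolseyAlpha)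
    have h5 : 2 * (k : ℝ) / wolseyAlpha * (2 * Real.log n) =
        4 / wolseyAlpha * (k * Real.log n) := by ring
    rw [h5] at h4
    rw [mul_assoc, add_mul]
    linarith

end MixedGreedy

end

theorem mainTheorem7 :
    (∀ n k : ℕ, k ≤ n →
      UtilityMonotone (kOfNUtility n k) ∧
      UtilitySubmodular (kOfNUtility n k) ∧
      HasGoalValue (kOfNUtility n k) (kOfNGoal n k) ∧
      (∀ b : PartialReal n Bool, kOfNUtility n k b = kOfNGoal n k ↔
        (n - k + 1 ≤ countState false b ∨ k ≤ countState true b)) ∧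
      (1 ≤ k → ∀ wc : PartialReal n Bool → Fin n → Bool, IsWorstCase (kOfNUtility n k) wc →
        ∃ ρ : ℝ, IsRho (kOfNUtility n k) (kOfNGoal n k) wc ρ ∧ 1 / (k : ℝ) ≤ ρ)) ∧
    (∃ C : ℝ, 0 < C ∧
      ∀ (n k : ℕ), k ≤ n →
      ∀ (tb : TieBreaking n Bool (kOfNUtility n k))
        (S : Finset (Fin n → Bool)) (w : (Fin n → Bool) → ℕ) (c : Fin n → ℝ),
        S.Nonempty → (∀ a ∈ S, 0 < w a) → (∀ i, 0 < c i) →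
        IsCoverStrategy (kOfNUtility n k) (kOfNGoal n k)
          (mixedGreedy (kOfNUtility n k) (kOfNGoal n k) tb S w c) ∧
        Computes (kOfNTree n k tb S w c) (kOfN n k) ∧
        (2 ≤ n → ∀ T : DTree n Bool Bool, Computes T (kOfN n k) →
          expectedCost S w c (kOfNTree n k tb S w c) ≤
            C * ((k : ℝ) * Real.log (n : ℝ)) * expectedCost S w c T)) := by
  refine ⟨fun n k hkn => ⟨kOfNUtility_monotone n k, kOfNUtility_submodular n k,
    kOfNUtility_hasGoalValue hkn, kOfNUtility_eq_goal_iff n k,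
    fun hk _ hwc => exists_isRho hkn hk hwc⟩, ?_⟩
  have hα := wolseyAlpha_pos
  have hl2 : 0 < Real.log 2 := Real.log_pos (by norm_num)
  refine ⟨24 * (1 / Real.log 2 + 4 / wolseyAlpha), by positivity, ?_⟩
  intro n k hkn tb S w c _ _ hc
  exact ⟨isCoverStrategy_mixedGreedy hkn tb hc, computes_kOfNTree hkn tb hc,
    fun hn _ hT => expectedCost_kOfNTree_le hkn hn tb hc hT⟩
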